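/- Let $n$ be a positive integer. Write $J=\begin{bmatrix}0&-I_n\\ I_n&0\end{bmatrix}$; for $X\in\mathbb{C}^{2n\times 2n}$ let $X^{\mathsf S}:=-JX^{\mathsf T}J$ be its symplectic adjoint, and let $\mathsf{Y}^2(\mathbb{C}^{2n}):=\{X\in\mathbb{C}^{2n\times 2n}:X=X^{\mathsf S}\}$. Let $\mathrm{U}(2n)$ be the group of unitary $2n\times 2n$ matrices and $\mathrm{Sp}(n):=\mathrm{U}(2n)\cap\mathrm{Sp}(2n,\mathbb{C})=\{Q\in\mathrm{U}(2n):Q^{\mathsf T}JQ=J\}$ the compact symplectic group. Let $\mathbb{H}$ be the quaternions, with $\mathbb{C}\subset\mathbb{H}$ as usual, and regard $\mathbb{H}^{2n}$ as a right $\mathbb{H}$-vector space with its standard skew-Hermitian form $\omega(x,y)=\sum_{a=1}^{2n}\bar x_a\,\mathrm{i}\,y_a$. Let $\mathrm{LGr}(\mathbb{H}^{2n})$ be the set of Lagrangian subspaces, i.e. the $\mathbb{H}$-subspaces $W\subseteq\mathbb{H}^{2n}$ that equal their own $\omega$-orthogonal complement. It is regarded as a submanifold of the quaternionic Grassmannian,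 where a subspace is identified with the orthogonal projection onto it, and $\mathrm{U}(2n)$ acts on it by $(A,W)\mapsto AW$. Then $$\mathrm{LGr}(\mathbb{H}^{2n})\;\cong\;\mathrm{U}(2n)/\mathrm{Sp}(n)\;\cong\;\{QQ^{\mathsf S}:Q\in\mathrm{U}(2n)\}\;=\;\mathrm{U}(2n)\cap\mathsf{Y}^2(\mathbb{C}^{2n})\;=\;\{X\in\mathrm{U}(2n):X=X^{\mathsf S}\}.$$ Here each $\cong$ is a $\mathrm{U}(2n)$-equivariant $C^\infty$ diffeomorphism. The homogeneous space $\mathrm{U}(2n)/\mathrm{Sp}(n)$ has its usual quotient manifold structure and the action by left multiplication, while $\{QQ^{\mathsf S}:Q\in\mathrm{U}(2n)\}$ is an embedded submanifold of $\mathbb{C}^{2n\times 2n}$ with the action $(A,X)\mapsto AXA^{\mathsf S}$. -/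

import Mathlib

open Matrix Manifold
open scoped ContDiff Quaternion MulOpposite

noncomputable section

namespace QLGr

/-! ### Complex matrices of size `2n` -/

/-- Complex `2n × 2n` matrices; the index set is written as two blocks of size `n`. -/
abbrev CMat (n : ℕ) : Type := Matrix (Fin n ⊕ Fin n) (Fin n ⊕ Fin n) ℂ

/-- The ambient real normed space `ℂ²ⁿˣ²ⁿ` (arrays of entries) in which sets of matrices are regarded
as submanifolds. All norms on it are equivalent. -/
abbrev Entries (n : ℕ) : Type := Fin n ⊕ Fin n → Fin n ⊕ Fin n → ℂ

/-- The array of entries of a matrix. -/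
def entries {n : ℕ} (X : CMat n) : Entries n := fun i j => X i j

/-- The unitary group `U(2n)`. -/
abbrev U2 (n : ℕ) : Submonoid (CMat n) := Matrix.unitaryGroup (Fin n ⊕ Fin n) ℂ

/-- The symplectic adjoint `-J Xᵀ J`, where `J` is the block matrix `[[0, -1], [1, 0]]`. -/
def sAdj {n : ℕ} (X : CMat n) : CMat n :=
  -(Matrix.J (Fin n) ℂ * Xᵀ * Matrix.J (Fin n) ℂ)

/-- The complex vector space `Y²(ℂ²ⁿ)` of symplectically symmetric matrices. -/
def Y2 (n : ℕ) : Submodule ℂ (CMat n) where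
  carrier := {X | X = sAdj X}
  add_mem' {X Y} hX hY := by
    have hX' : X = sAdj X := hX
    have hY' : Y = sAdj Y := hY
    change X + Y = sAdj (X + Y)
    conv_lhs => rw [hX', hY']
    simp [sAdj, Matrix.mul_add, Matrix.add_mul, add_comm]
  zero_mem' := by
    change (0 : CMat n) = sAdj 0
    simp [sAdj]
  smul_mem' c X hX := by
    have hX' : X = sAdj X := hX
    change c • X = sAdj (c • X)
    conv_lhs => rw [hX']
    simp [sAdj]

/-- The compact symplectic group `Sp(n) = U(2n) ∩ Sp(2n, ℂ)`, as a subgroup of `U(2n)`. -/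
def Sp (n : ℕ) : Subgroup (U2 n) where
  carrier := {Q | (Q : CMat n) ∈ Matrix.symplecticGroup (Fin n) ℂ}
  mul_mem' {P Q} hP hQ := (Matrix.symplecticGroup (Fin n) ℂ).mul_mem hP hQ
  one_mem' := (Matrix.symplecticGroup (Fin n) ℂ).one_mem
  inv_mem' {Q} hQ := by
    have hQ' : (Q : CMat n) ∈ Matrix.symplecticGroup (Fin n) ℂ := hQ
    have h1 : ((Q⁻¹ : U2 n) : CMat n) * (Q : CMat n) = 1 := by
      rw [← Submonoid.coe_mul, inv_mul_cancel, Submonoid.coe_one]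
    have h2 : (Q : CMat n)⁻¹ = ((Q⁻¹ : U2 n) : CMat n) := Matrix.inv_eq_left_inv h1
    have h3 := SymplecticGroup.coe_inv' (⟨(Q : CMat n), hQ'⟩ : Matrix.symplecticGroup (Fin n) ℂ)
    change ((Q⁻¹ : U2 n) : CMat n) ∈ Matrix.symplecticGroup (Fin n) ℂ
    rw [← h2]
    simp only at h3
    rw [← h3]
    exact Subtype.property _

/-- The set of matrices `Q Q^S` with `Q` unitary. -/
def squares (n : ℕ) : Set (CMat n) := {X | ∃ Q ∈ U2 n, X = Q * sAdj Q}

/-! ### Quaternionic Lagrangian subspaces -/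

/-- The right quaternionic vector space `ℍ²ⁿ` (scalars act through `ℍᵐᵒᵖ`), with its standard
Euclidean inner product as a real vector space. -/
abbrev HVec (n : ℕ) : Type := PiLp 2 (fun _ : Fin n ⊕ Fin n => ℍ[ℝ])

/-- The standard skew-Hermitian form `∑ₐ x̄ₐ i yₐ` on `ℍ²ⁿ`. -/
def skewForm {n : ℕ} (x y : HVec n) : ℍ[ℝ] :=
  ∑ a, star (x a) * ((Complex.I : ℂ) : ℍ[ℝ]) * y a

/-- A subspace is Lagrangian if it equals its orthogonal complement for the form. -/
def IsLagrangian {n : ℕ} (W : Submodule ℍ[ℝ]ᵐᵒᵖ (HVec n)) : Prop :=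
  ∀ x, x ∈ W ↔ ∀ y ∈ W, skewForm x y = 0

/-- The set of Lagrangian subspaces of `ℍ²ⁿ`. -/
def LGr (n : ℕ) : Type := {W : Submodule ℍ[ℝ]ᵐᵒᵖ (HVec n) // IsLagrangian W}

/-- The orthogonal projection of `ℍ²ⁿ` onto a Lagrangian subspace. The orthogonal complement of a
quaternionic subspace for the Hermitian form `∑ₐ x̄ₐ yₐ` is its complement for the real inner
product, so this is also the quaternionic orthogonal projection. -/
def proj {n : ℕ} (W : LGr n) : HVec n →L[ℝ] HVec n :=
  (W.1.restrictScalars ℝ).starProjection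

/-- The topology of `LGr` as a subspace of the Grassmannian, i.e. as a space of orthogonal
projections. -/
instance (n : ℕ) : TopologicalSpace (LGr n) := TopologicalSpace.induced proj inferInstance

/-- A complex matrix acting on `ℍ²ⁿ` by multiplication from the left, where `ℂ ⊆ ℍ`. -/
def act {n : ℕ} (A : CMat n) : HVec n →ₗ[ℍ[ℝ]ᵐᵒᵖ] HVec n where
  toFun x := WithLp.toLp 2 (fun a => ∑ b, ((A a b : ℂ) : ℍ[ℝ]) * x b)
  map_add' x y := by
    ext1 a
    simp [mul_add, Finset.sum_add_distrib]
  map_smul' c x := by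
    ext1 a
    simp [Finset.sum_mul, mul_assoc]

theorem act_apply {n : ℕ} (A : CMat n) (x : HVec n) (a : Fin n ⊕ Fin n) :
    act A x a = ∑ b, ((A a b : ℂ) : ℍ[ℝ]) * x b := rfl

theorem act_one {n : ℕ} : act (1 : CMat n) = LinearMap.id := by
  ext1 x
  ext1 a
  simp [act_apply, Matrix.one_apply, apply_ite Quaternion.coeComplex]

theorem coe_sum {ι : Type*} (s : Finset ι) (f : ι → ℂ) :
    ((∑ i ∈ s, f i : ℂ) : ℍ[ℝ]) = ∑ i ∈ s, ((f i : ℂ) : ℍ[ℝ]) :=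
  map_sum Quaternion.ofComplex f s

theorem act_mul {n : ℕ} (A B : CMat n) : act (A * B) = act A ∘ₗ act B := by
  ext1 x
  ext1 a
  simp only [act_apply, Matrix.mul_apply, LinearMap.comp_apply, coe_sum, Finset.sum_mul,
    Finset.mul_sum, Quaternion.coeComplex_mul, mul_assoc]
  rw [Finset.sum_comm]

theorem coe_star (z : ℂ) : ((star z : ℂ) : ℍ[ℝ]) = star (z : ℍ[ℝ]) := by
  ext <;> simp

theorem skewForm_act {n : ℕ} (A : CMat n) (x y : HVec n) :
    skewForm (act A x) y = skewForm x (act (star A) y) := by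
  have hc : ∀ z : ℂ, (z : ℍ[ℝ]) * ((Complex.I : ℂ) : ℍ[ℝ]) = ((Complex.I : ℂ) : ℍ[ℝ]) * z := by
    intro z
    rw [← Quaternion.coeComplex_mul, ← Quaternion.coeComplex_mul, mul_comm]
  simp only [skewForm, act_apply, star_sum, star_mul, Finset.sum_mul, Finset.mul_sum,
    Matrix.star_apply, coe_star]
  rw [Finset.sum_comm]
  refine Finset.sum_congr rfl fun b _ => Finset.sum_congr rfl fun a _ => ?_
  rw [← coe_star, mul_assoc (star (x b)), hc]
  simp only [mul_assoc]

theorem act_star_act {n : ℕ} (A : U2 n) (x : HVec n) : act (star (A : CMat n)) (act A x) = x := by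
  rw [← LinearMap.comp_apply, ← act_mul, Unitary.coe_star_mul_self, act_one, LinearMap.id_apply]

theorem act_act_star {n : ℕ} (A : U2 n) (x : HVec n) : act (A : CMat n) (act (star A.1) x) = x := by
  rw [← LinearMap.comp_apply, ← act_mul, Unitary.mul_star_self_of_mem A.2, act_one,
    LinearMap.id_apply]

theorem IsLagrangian.map {n : ℕ} (A : U2 n) {W : Submodule ℍ[ℝ]ᵐᵒᵖ (HVec n)}
    (hW : IsLagrangian W) : IsLagrangian (W.map (act (A : CMat n))) := by
  intro x
  have h1 : x ∈ W.map (act (A : CMat n)) ↔ act (star A.1) x ∈ W := by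
    constructor
    · rintro ⟨w, hw, rfl⟩
      rwa [act_star_act]
    · intro h
      exact ⟨_, h, act_act_star A x⟩
  rw [h1, hW]
  constructor
  · rintro h _ ⟨w, hw, rfl⟩
    have := h w hw
    rwa [skewForm_act, star_star] at this
  · intro h w hw
    rw [skewForm_act, star_star]
    exact h _ ⟨w, hw, rfl⟩

/-- The natural action of `U(2n)` on Lagrangian subspaces: `A • W` is the image of `W`. -/
instance (n : ℕ) : MulAction (U2 n) (LGr n) where
  smul A W := ⟨W.1.map (act (A : CMat n)), W.2.map A⟩
  one_smul W := Subtype.ext <| by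
    change W.1.map (act (1 : CMat n)) = W.1
    rw [act_one, Submodule.map_id]
  mul_smul A B W := Subtype.ext <| by
    change W.1.map (act ((A : CMat n) * (B : CMat n))) = (W.1.map (act (B : CMat n))).map (act A.1)
    rw [act_mul, Submodule.map_comp]

/-! ### Smooth quotients -/

/-- The manifold structure of a homogeneous space `G ⧸ H` (it is the unique one with these two
properties): the quotient map is smooth and has smooth local sections. -/
def IsSmoothQuotient {k d : ℕ} {G : Type*} [Group G] [TopologicalSpace G]
    [ChartedSpace (EuclideanSpace ℝ (Fin k)) G] (H : Subgroup G)
    [ChartedSpace (EuclideanSpace ℝ (Fin d)) (G ⧸ H)] : Prop :=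
  ContMDiff (𝓡 k) (𝓡 d) ∞ (QuotientGroup.mk : G → G ⧸ H) ∧
    ∀ q : G ⧸ H, ∃ V : Set (G ⧸ H), IsOpen V ∧ q ∈ V ∧ ∃ s : G ⧸ H → G,
      ContMDiffOn (𝓡 d) (𝓡 k) ∞ s V ∧ ∀ p ∈ V, (QuotientGroup.mk (s p) : G ⧸ H) = p

end QLGr

end

/-!
The Cayley transform `X ↦ (1 - X) / (1 + X)` straightens both `U(2n)` and `{X ∈ U(2n) : X = X^S}`
to linear subspaces near `1`, and translations by `X ↦ P X Q` carry these slice charts to all other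
points. A symplectically symmetric unitary matrix `X` has a square root `Q` which is unitary and a
polynomial in `X`; hence `Q` is symplectically symmetric too and `X = Q Q^S`.

The map `[Q] ↦ Q Q^S` identifies `U(2n)/Sp(n)` with this submanifold, because `Q Q^S = 1` is the
condition `Qᵀ J Q = J` for unitary `Q`. The smooth square root near `1` commutes with `X ↦ X^S` and
preserves unitarity, so it is a smooth local section.

A subspace `W` is Lagrangian if and only if the reflection in `W` anticommutes with `i`. The
endomorphisms of `ℍ²ⁿ` which do so are the maps `-X J j` with a complex matrix `X`, and the
involution and symmetry conditions on a reflection become `X ∈ U(2n)` and `X = X^S`.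
-/

noncomputable section

namespace QLGr

/-! ### Submanifolds cut out by slice charts -/

section Slices

open Topology Set

variable {E : Type*} [NormedAddCommGroup E] [NormedSpace ℝ E]
  {E' : Type*} [NormedAddCommGroup E'] [NormedSpace ℝ E'] {S : Set E} {F : Submodule ℝ E}

/-- A smooth ambient chart which straightens the set `S` to the linear subspace `F`. -/
structure SliceChart (S : Set E) (F : Submodule ℝ E) extends OpenPartialHomeomorph E E where
  contDiffOn_toFun : ContDiffOn ℝ ∞ toFun source
  contDiffOn_invFun : ContDiffOn ℝ ∞ invFun target
  mem_iff : ∀ y ∈ source, y ∈ S ↔ toFun y ∈ F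

/-- `S` is an embedded submanifold modelled on the linear subspace `F`: it has slice charts around
each of its points. -/
def IsSliced (S : Set E) (F : Submodule ℝ E) : Prop :=
  ∀ x ∈ S, ∃ φ : SliceChart S F, x ∈ φ.source

/-- The slice chart of an image under an ambient diffeomorphism `g`; the model subspace is moved by
an unrelated linear equivalence `L`. -/
def SliceChart.image (φ : SliceChart S F) (g : E ≃ₜ E') (hg : ContDiff ℝ ∞ g)
    (hg' : ContDiff ℝ ∞ g.symm) (L : E ≃L[ℝ] E') :
    SliceChart (g '' S) (F.map (L : E →ₗ[ℝ] E')) where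
  toOpenPartialHomeomorph := (g.symm.toOpenPartialHomeomorph.trans φ.toOpenPartialHomeomorph).trans
    L.toHomeomorph.toOpenPartialHomeomorph
  contDiffOn_toFun := L.contDiff.comp_contDiffOn
    (φ.contDiffOn_toFun.comp hg'.contDiffOn fun _ hy => hy.1.2)
  contDiffOn_invFun := hg.comp_contDiffOn
    (φ.contDiffOn_invFun.comp L.symm.contDiff.contDiffOn fun _ hy => hy.2.1)
  mem_iff y hy := by
    have hmem : g.symm y ∈ S ↔ φ.toFun (g.symm y) ∈ F := φ.mem_iff _ hy.1.2
    rw [g.image_eq_preimage_symm, mem_preimage, hmem]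
    exact L.injective.mem_set_image.symm

/-- The slice chart of `S × {0}`. -/
def SliceChart.prodZero (φ : SliceChart S F) :
    SliceChart (S ×ˢ ({0} : Set E')) (F.prod (⊥ : Submodule ℝ E')) where
  toOpenPartialHomeomorph := φ.toOpenPartialHomeomorph.prod (.refl E')
  contDiffOn_toFun := φ.contDiffOn_toFun.prodMap contDiffOn_id
  contDiffOn_invFun := φ.contDiffOn_invFun.prodMap contDiffOn_id
  mem_iff _ hy := and_congr (φ.mem_iff _ hy.1) Iff.rfl

theorem IsSliced.image (h : IsSliced S F) (g : E ≃ₜ E') (hg : ContDiff ℝ ∞ g)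
    (hg' : ContDiff ℝ ∞ g.symm) (L : E ≃L[ℝ] E') :
    IsSliced (g '' S) (F.map (L : E →ₗ[ℝ] E')) := by
  rintro _ ⟨x, hx, rfl⟩
  obtain ⟨φ, hxφ⟩ := h x hx
  exact ⟨φ.image g hg hg' L, by simpa [SliceChart.image] using hxφ⟩

theorem IsSliced.prodZero (h : IsSliced S F) :
    IsSliced (S ×ˢ ({0} : Set E')) (F.prod (⊥ : Submodule ℝ E')) := by
  rintro ⟨x, y⟩ ⟨hx, -⟩
  obtain ⟨φ, hxφ⟩ := h x hx
  exact ⟨φ.prodZero, hxφ, trivial⟩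

theorem SliceChart.isSliced_of_forall_exists_homeomorph (φ : SliceChart S F) {x₀ : E}
    (hx₀ : x₀ ∈ φ.source)
    (h : ∀ x ∈ S, ∃ g : E ≃ₜ E, ContDiff ℝ ∞ g ∧ ContDiff ℝ ∞ g.symm ∧ g x₀ = x ∧ g '' S = S) :
    IsSliced S F := by
  intro x hx
  obtain ⟨g, hg, hg', rfl, hgS⟩ := h x hx
  have hφ : ∃ ψ : SliceChart (g '' S) (F.map (.id : E →ₗ[ℝ] E)), g x₀ ∈ ψ.source :=
    ⟨φ.image g hg hg' (.refl ℝ E), by simpa [SliceChart.image] using hx₀⟩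
  rwa [hgS, Submodule.map_id] at hφ

theorem exists_prod_equiv_extending [FiniteDimensional ℝ E] [FiniteDimensional ℝ E']
    {i : E →ₗ[ℝ] E'} (hi : Function.Injective i) :
    ∃ (C : Submodule ℝ E') (T : (E × C) ≃L[ℝ] E'), ∀ y, T (y, 0) = i y := by
  obtain ⟨C, hC⟩ := (LinearMap.range i).exists_isCompl
  exact ⟨C, (((LinearEquiv.ofInjective i hi).prodCongr (.refl ℝ C)).trans
    (Submodule.prodEquivOfIsCompl _ C hC)).toContinuousLinearEquiv, fun y => by simp⟩

theorem IsSliced.image_affineMap [FiniteDimensional ℝ E] [FiniteDimensional ℝ E']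
    (h : IsSliced S F) {i : E →ᵃ[ℝ] E'} (hi : Function.Injective i) :
    IsSliced (i '' S) (F.map i.linear) := by
  obtain ⟨C, T, hT⟩ := exists_prod_equiv_extending (i.linear_injective_iff.2 hi)
  let g : (E × C) ≃ₜ E' := T.toHomeomorph.trans (Homeomorph.addRight (i 0))
  have hgi (y : E) : g (y, 0) = i y := by
    rw [i.decomp]
    exact congrArg (· + i 0) (hT y)
  have hS : g '' (S ×ˢ {0}) = i '' S := by
    simp only [prod_singleton, image_image, hgi]
  have hF : (F.prod ⊥).map (T : (E × C) →ₗ[ℝ] E') = F.map i.linear :=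
    SetLike.coe_injective <| by
      simp only [Submodule.map_coe, Submodule.prod_coe, Submodule.bot_coe, prod_singleton,
        image_image]
      exact image_congr fun y _ => hT y
  rw [← hS, ← hF]
  exact h.prodZero.image g (T.contDiff.add contDiff_const)
    (T.symm.contDiff.comp (contDiff_id.add contDiff_const)) T

theorem exists_prod_equiv_of_finrank_eq [FiniteDimensional ℝ E] {d : ℕ}
    (hd : Module.finrank ℝ F = d) :
    ∃ (C : Submodule ℝ E) (e : (EuclideanSpace ℝ (Fin d) × C) ≃L[ℝ] E),
      ∀ y, y ∈ F ↔ (e.symm y).2 = 0 := by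
  obtain ⟨C, hC⟩ := F.exists_isCompl
  let k : EuclideanSpace ℝ (Fin d) ≃ₗ[ℝ] F := LinearEquiv.ofFinrankEq _ _ (by simp [hd])
  exact ⟨C, ((k.prodCongr (.refl ℝ C)).trans
    (Submodule.prodEquivOfIsCompl F C hC)).toContinuousLinearEquiv,
    fun _ => (Submodule.prodEquivOfIsCompl_symm_apply_snd_eq_zero F C hC).symm⟩

variable {M : Type*} {f : M → E}
  {V : Type*} [NormedAddCommGroup V] [NormedSpace ℝ V]
  {C : Type*} [NormedAddCommGroup C] [NormedSpace ℝ C]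

theorem SliceChart.apply_fst_symm_apply (φ : SliceChart (range f) F) {e : (V × C) ≃L[ℝ] E}
    (he : ∀ y, y ∈ F ↔ (e.symm y).2 = 0) {m : M} (hm : f m ∈ φ.source) :
    e ((e.symm (φ.toFun (f m))).1, 0) = φ.toFun (f m) := by
  rw [← (he _).1 ((φ.mem_iff _ hm).1 ⟨m, rfl⟩), e.apply_symm_apply]

theorem SliceChart.apply_invFun [Nonempty M] (φ : SliceChart (range f) F)
    {e : (V × C) ≃L[ℝ] E} (he : ∀ y, y ∈ F ↔ (e.symm y).2 = 0) {u : V}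
    (hu : e (u, 0) ∈ φ.target) :
    f (Function.invFun f (φ.invFun (e (u, 0)))) = φ.invFun (e (u, 0)) :=
  Function.invFun_eq <| (φ.mem_iff _ (φ.map_target' hu)).2 <| (he _).2 <| by
    rw [φ.right_inv' hu, e.symm_apply_apply]

variable [TopologicalSpace M]

/-- The chart of `M` which an ambient slice chart for the image of an embedding induces. -/
def SliceChart.restrict [Nonempty M] (φ : SliceChart (range f) F) (hf : IsEmbedding f)
    (e : (V × C) ≃L[ℝ] E) (he : ∀ y, y ∈ F ↔ (e.symm y).2 = 0) : OpenPartialHomeomorph M V where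
  toFun m := (e.symm (φ.toFun (f m))).1
  invFun u := Function.invFun f (φ.invFun (e (u, 0)))
  source := f ⁻¹' φ.source
  target := {u | e (u, 0) ∈ φ.target}
  map_source' m hm := by
    rw [mem_ofPred_eq, φ.apply_fst_symm_apply he hm]
    exact φ.map_source' hm
  map_target' u hu := by
    rw [mem_preimage, φ.apply_invFun he hu]
    exact φ.map_target' hu
  left_inv' m hm := by
    rw [φ.apply_fst_symm_apply he hm, φ.left_inv' hm]
    exact Function.leftInverse_invFun hf.injective m
  right_inv' u hu := by
    rw [φ.apply_invFun he hu, φ.right_inv' hu, e.symm_apply_apply]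
  open_source := φ.open_source.preimage hf.continuous
  open_target := φ.open_target.preimage (by fun_prop)
  continuousOn_toFun := (continuous_fst.comp e.symm.continuous).comp_continuousOn
    (φ.continuousOn_toFun.comp hf.continuous.continuousOn fun _ h => h)
  continuousOn_invFun := by
    rw [hf.continuousOn_iff]
    exact (φ.continuousOn_invFun.comp (s := {u : V | e (u, 0) ∈ φ.target}) (by fun_prop)
      fun _ h => h).congr fun _ hu => φ.apply_invFun he hu

theorem SliceChart.contDiffOn_restrict_symm_trans_restrict [Nonempty M]
    (φ ψ : SliceChart (range f) F) (hf : IsEmbedding f) (e : (V × C) ≃L[ℝ] E)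
    (he : ∀ y, y ∈ F ↔ (e.symm y).2 = 0) :
    ContDiffOn ℝ ∞ ((φ.restrict hf e he).symm.trans (ψ.restrict hf e he))
      ((φ.restrict hf e he).symm.trans (ψ.restrict hf e he)).source := by
  have hinv : ContDiffOn ℝ ∞ (fun u : V => φ.invFun (e (u, 0))) {u | e (u, 0) ∈ φ.target} :=
    φ.contDiffOn_invFun.comp (e.contDiff.comp (contDiff_id.prodMk contDiff_const)).contDiffOn
      fun _ hu => hu
  refine ((e.symm.contDiff.fst.comp_contDiffOn ψ.contDiffOn_toFun).comp
    (hinv.mono inter_subset_left) fun u hu => ?_).congr fun u hu => ?_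
  · rw [← φ.apply_invFun he hu.1]
    exact hu.2
  · exact congrArg (fun y => (e.symm (ψ.toFun y)).1) (φ.apply_invFun he hu.1)

/-- The charted space structure on `M` induced by slice charts for the image of an embedding. -/
@[reducible]
def SliceChart.chartedSpace (φ : M → SliceChart (range f) F) (hφ : ∀ m, f m ∈ (φ m).source)
    (hf : IsEmbedding f) (e : (V × C) ≃L[ℝ] E) (he : ∀ y, y ∈ F ↔ (e.symm y).2 = 0) :
    ChartedSpace V M where
  atlas := range fun m => haveI : Nonempty M := ⟨m⟩; (φ m).restrict hf e he
  chartAt m := haveI : Nonempty M := ⟨m⟩; (φ m).restrict hf e he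
  mem_chart_source := hφ
  chart_mem_atlas := mem_range_self

theorem SliceChart.isManifold_chartedSpace (φ : M → SliceChart (range f) F)
    (hφ : ∀ m, f m ∈ (φ m).source) (hf : IsEmbedding f) (e : (V × C) ≃L[ℝ] E)
    (he : ∀ y, y ∈ F ↔ (e.symm y).2 = 0) :
    letI := SliceChart.chartedSpace φ hφ hf e he
    IsManifold 𝓘(ℝ, V) ∞ M := by
  let := SliceChart.chartedSpace φ hφ hf e he
  refine isManifold_of_contDiffOn _ _ _ ?_
  rintro _ _ ⟨m, rfl⟩ ⟨m', rfl⟩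
  have : Nonempty M := ⟨m⟩
  simpa only [modelWithCornersSelf_coe, modelWithCornersSelf_coe_symm, Function.id_comp,
    Function.comp_id, range_id, inter_univ, preimage_id_eq, id] using
    (φ m).contDiffOn_restrict_symm_trans_restrict (φ m') hf e he

theorem SliceChart.isSmoothEmbedding_chartedSpace (φ : M → SliceChart (range f) F)
    (hφ : ∀ m, f m ∈ (φ m).source) (hf : IsEmbedding f) (e : (V × C) ≃L[ℝ] E)
    (he : ∀ y, y ∈ F ↔ (e.symm y).2 = 0) :
    letI := SliceChart.chartedSpace φ hφ hf e he
    IsSmoothEmbedding 𝓘(ℝ, V) 𝓘(ℝ, E) ∞ f := by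
  let := SliceChart.chartedSpace φ hφ hf e he
  have := SliceChart.isManifold_chartedSpace φ hφ hf e he
  refine ⟨IsImmersionOfComplement.isImmersion (F := C) fun m => ?_, hf⟩
  have : Nonempty M := ⟨m⟩
  refine IsImmersionAtOfComplement.mk_of_continuousAt hf.continuous.continuousAt e
    ((φ m).restrict hf e he) (φ m).toOpenPartialHomeomorph (hφ m) (hφ m)
    (IsManifold.subset_maximalAtlas ⟨m, rfl⟩) ?_ ?_
  · rw [IsManifold.mem_maximalAtlas_iff_contMDiffOn]
    exact ⟨contMDiffOn_iff_contDiffOn.2 (φ m).contDiffOn_toFun,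
      contMDiffOn_iff_contDiffOn.2 (φ m).contDiffOn_invFun⟩
  · intro u hu
    rw [OpenPartialHomeomorph.extend_target] at hu
    exact (congrArg (φ m).toFun ((φ m).apply_invFun he hu.1)).trans ((φ m).right_inv' hu.1)

theorem IsSliced.exists_chartedSpace [FiniteDimensional ℝ E] (hS : IsSliced S F) {d : ℕ}
    (hd : Module.finrank ℝ F = d) (hf : IsEmbedding f) (hr : range f = S) :
    ∃ _ : ChartedSpace (EuclideanSpace ℝ (Fin d)) M,
      IsManifold (𝓡 d) ∞ M ∧ IsSmoothEmbedding (𝓡 d) 𝓘(ℝ, E) ∞ f := by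
  obtain ⟨C, e, he⟩ := exists_prod_equiv_of_finrank_eq hd
  subst hr
  choose φ hφ using fun m : M => hS (f m) ⟨m, rfl⟩
  exact ⟨SliceChart.chartedSpace φ hφ hf e he, SliceChart.isManifold_chartedSpace φ hφ hf e he,
    SliceChart.isSmoothEmbedding_chartedSpace φ hφ hf e he⟩

theorem IsSliced.exists_chartedSpace_of_range_eq_image [FiniteDimensional ℝ E]
    [FiniteDimensional ℝ E'] (hS : IsSliced S F) {i : E →ᵃ[ℝ] E'} (hi : Function.Injective i)
    {f : M → E'} (hf : IsEmbedding f) (hr : range f = i '' S) :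
    ∃ _ : ChartedSpace (EuclideanSpace ℝ (Fin (Module.finrank ℝ F))) M,
      IsManifold (𝓡 (Module.finrank ℝ F)) ∞ M ∧
        IsSmoothEmbedding (𝓡 (Module.finrank ℝ F)) 𝓘(ℝ, E') ∞ f :=
  (hS.image_affineMap hi).exists_chartedSpace
    (F.equivMapOfInjective _ (i.linear_injective_iff.2 hi)).symm.finrank_eq hf hr

end Slices

/-! ### The Cayley transform -/

section Cayley

open scoped Ring

section Algebra

variable {A : Type*} [Ring A] {a b : A}

/-- The Cayley transform `(1 - a) (1 + a)⁻¹`, meaningful where `1 + a` is invertible. -/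
def cayley (a : A) : A := (1 - a) * (1 + a)⁻¹ʳ

theorem eq_cayley_iff (h : IsUnit (1 + a)) : b = cayley a ↔ b * (1 + a) = 1 - a :=
  Ring.eq_mul_inverse_iff_mul_eq _ _ _ h

theorem cayley_mul_one_add (h : IsUnit (1 + a)) : cayley a * (1 + a) = 1 - a :=
  (eq_cayley_iff h).1 rfl

theorem one_add_mul_cayley (h : IsUnit (1 + a)) : (1 + a) * cayley a = 1 - a := by
  have hcomm : (1 + a) * (1 - a) = (1 - a) * (1 + a) := by noncomm_ring
  rw [cayley, ← mul_assoc, hcomm, Ring.mul_inverse_cancel_right _ _ h]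

theorem one_add_cayley (h : IsUnit (1 + a)) : 1 + cayley a = 2 * (1 + a)⁻¹ʳ := by
  rw [Ring.eq_mul_inverse_iff_mul_eq _ _ _ h, add_mul, cayley_mul_one_add h, one_mul,
    add_add_sub_cancel, one_add_one_eq_two]

theorem isUnit_one_add_cayley (h2 : IsUnit (2 : A)) (h : IsUnit (1 + a)) :
    IsUnit (1 + cayley a) := by
  rw [one_add_cayley h]
  exact h2.mul h.ringInverse

theorem cayley_cayley (h2 : IsUnit (2 : A)) (h : IsUnit (1 + a)) : cayley (cayley a) = a := by
  refine ((eq_cayley_iff (isUnit_one_add_cayley h2 h)).2 ?_).symm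
  calc a * (1 + cayley a) = a + (1 + a) * cayley a - cayley a := by noncomm_ring
    _ = 1 - cayley a := by rw [one_add_mul_cayley h, add_sub_cancel]

theorem cayley_inj (h2 : IsUnit (2 : A)) (ha : IsUnit (1 + a)) (hb : IsUnit (1 + b)) :
    cayley a = cayley b ↔ a = b :=
  ⟨fun h => by rw [← cayley_cayley h2 ha, h, cayley_cayley h2 hb], congrArg cayley⟩

theorem unop_map_cayley {B : Type*} [Ring B] (σ : A →+* Bᵐᵒᵖ) (h : IsUnit (1 + a)) :
    (σ (cayley a)).unop = cayley (σ a).unop := by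
  have h' : IsUnit (1 + (σ a).unop) := by simpa using (h.map σ).unop
  rw [eq_cayley_iff h']
  simpa using congrArg (fun x => (σ x).unop) (one_add_mul_cayley h)

theorem star_cayley [StarRing A] (h : IsUnit (1 + a)) : star (cayley a) = cayley (star a) :=
  unop_map_cayley (starRingEquiv : A ≃+* Aᵐᵒᵖ).toRingHom h

theorem star_cayley_eq_neg_iff [StarRing A] (h2 : IsUnit (2 : A)) (h : IsUnit (1 + a)) :
    star (cayley a) = -cayley a ↔ star a * a = 1 := by
  have hstar : (1 + star a) * star (cayley a) = 1 - star a := by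
    simpa using congrArg star (cayley_mul_one_add h)
  have h' : IsUnit (1 + star a) := by simpa using h.star
  have key : (1 + star a) * (star (cayley a) + cayley a) * (1 + a) = 2 * (1 - star a * a) := by
    rw [mul_add (1 + star a), add_mul _ _ (1 + a), hstar, mul_assoc, cayley_mul_one_add h]
    noncomm_ring
  rw [eq_neg_iff_add_eq_zero, ← h'.mul_right_eq_zero, ← h.mul_left_eq_zero, key,
    h2.mul_right_eq_zero, sub_eq_zero, eq_comm]

theorem star_cayley_eq_neg_iff_mem_unitary [StarRing A] (h2 : IsUnit (2 : A))
    (h : IsUnit (1 + a)) : star (cayley a) = -cayley a ↔ a ∈ unitary A := by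
  rw [Unitary.mem_iff, and_iff_left_of_imp, star_cayley_eq_neg_iff h2 h]
  intro hunit
  have hskew := (star_cayley_eq_neg_iff h2 h).2 hunit
  rw [← star_star a, star_star (star a), ← star_cayley_eq_neg_iff h2 (by simpa using h.star),
    ← star_cayley h, star_star, hskew, neg_neg]

theorem mul_mul_mem_unitary_iff [StarRing A] (P Q : unitary A) :
    P * a * Q ∈ unitary A ↔ a ∈ unitary A := by
  refine ⟨fun h => ?_, fun h => mul_mem (mul_mem P.2 h) Q.2⟩
  have ha : a = star (P : A) * (P * a * Q) * star (Q : A) := by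
    simp [mul_assoc, ← mul_assoc (star (P : A)) P a]
  exact ha ▸ mul_mem (mul_mem (star P).2 h) (star Q).2

end Algebra

section Normed

variable {A : Type*} [NormedRing A] [CompleteSpace A]

theorem isOpen_isUnit_one_add : IsOpen {a : A | IsUnit (1 + a)} :=
  Units.isOpen.preimage (continuous_const.add continuous_id)

variable [NormedAlgebra ℝ A]

theorem isUnit_two {A : Type*} [NormedRing A] [NormedAlgebra ℝ A] : IsUnit (2 : A) := by
  simpa only [map_ofNat] using (IsUnit.mk0 (2 : ℝ) two_ne_zero).map (algebraMap ℝ A)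

theorem contDiffOn_cayley : ContDiffOn ℝ ∞ (cayley : A → A) {a | IsUnit (1 + a)} := by
  rintro a ⟨u, hu⟩
  have hinv := contDiffAt_ringInverse ℝ (n := ∞) u
  rw [hu] at hinv
  exact ((contDiffAt_const.sub contDiffAt_id).mul
    (hinv.comp a (contDiffAt_const.add contDiffAt_id))).contDiffWithinAt

/-- The Cayley transform as an involutive chart around `1`. -/
def cayleyHomeomorph (A : Type*) [NormedRing A] [CompleteSpace A] [NormedAlgebra ℝ A] :
    OpenPartialHomeomorph A A where
  toFun := cayley
  invFun := cayley
  source := {a | IsUnit (1 + a)}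
  target := {a | IsUnit (1 + a)}
  map_source' _ h := isUnit_one_add_cayley isUnit_two h
  map_target' _ h := isUnit_one_add_cayley isUnit_two h
  left_inv' _ h := cayley_cayley isUnit_two h
  right_inv' _ h := cayley_cayley isUnit_two h
  open_source := isOpen_isUnit_one_add
  open_target := isOpen_isUnit_one_add
  continuousOn_toFun := contDiffOn_cayley.continuousOn
  continuousOn_invFun := contDiffOn_cayley.continuousOn

theorem one_mem_source_cayleyHomeomorph : (1 : A) ∈ (cayleyHomeomorph A).source := by
  simpa only [cayleyHomeomorph, Set.mem_ofPred_eq, one_add_one_eq_two] using isUnit_two (A := A)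

/-- The Cayley transform as a slice chart of a set which it carries to a linear subspace. -/
def cayleySlice {S : Set A} {F : Submodule ℝ A}
    (h : ∀ a, IsUnit (1 + a) → (a ∈ S ↔ cayley a ∈ F)) : SliceChart S F where
  toOpenPartialHomeomorph := cayleyHomeomorph A
  contDiffOn_toFun := contDiffOn_cayley
  contDiffOn_invFun := contDiffOn_cayley
  mem_iff := h

/-- The self-homeomorphism `x ↦ a x b` for units `a` and `b`. -/
def mulUnitsHomeomorph (a b : Aˣ) : A ≃ₜ A where
  toEquiv := a.mulLeft.trans b.mulRight
  continuous_toFun := (continuous_const.mul continuous_id).mul continuous_const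
  continuous_invFun := continuous_const.mul (continuous_id.mul continuous_const)

theorem isSliced_of_cayley {S : Set A} {F : Submodule ℝ A}
    (h : ∀ a, IsUnit (1 + a) → (a ∈ S ↔ cayley a ∈ F))
    (htrans : ∀ x ∈ S, ∃ a b : Aˣ, (a * b : A) = x ∧ ∀ y : A, a * y * b ∈ S ↔ y ∈ S) :
    IsSliced S F := by
  refine (cayleySlice h).isSliced_of_forall_exists_homeomorph one_mem_source_cayleyHomeomorph
    fun x hx => ?_
  obtain ⟨a, b, rfl, hab⟩ := htrans x hx
  refine ⟨mulUnitsHomeomorph a b, (contDiff_const.mul contDiff_id).mul contDiff_const,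
    contDiff_const.mul (contDiff_id.mul contDiff_const), congrArg (· * (b : A)) (mul_one _), ?_⟩
  have hpre : mulUnitsHomeomorph a b ⁻¹' S = S := Set.ext hab
  conv_lhs => rw [← hpre]
  exact (mulUnitsHomeomorph a b).image_preimage S

theorem isSliced_unitary [StarRing A] [StarModule ℝ A] :
    IsSliced (unitary A : Set A) (skewAdjoint.submodule ℝ A) := by
  refine isSliced_of_cayley (fun a ha => ?_) fun Q hQ => ?_
  · exact (star_cayley_eq_neg_iff_mem_unitary isUnit_two ha).symm
  · exact ⟨Unitary.toUnits ⟨Q, hQ⟩, 1, mul_one Q, fun _ => mul_mul_mem_unitary_iff ⟨Q, hQ⟩ 1⟩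

end Normed

end Cayley

/-! ### The symplectic adjoint -/

section SymplecticAdjoint

variable {n : ℕ}

theorem sAdj_add (X Y : CMat n) : sAdj (X + Y) = sAdj X + sAdj Y := by
  simp [sAdj, mul_add, add_mul, add_comm]

theorem sAdj_smul (c : ℂ) (X : CMat n) : sAdj (c • X) = c • sAdj X := by
  simp [sAdj]

theorem sAdj_one : sAdj (1 : CMat n) = 1 := by
  simp [sAdj, Matrix.J_squared]

theorem J_mul_J_mul (Z : CMat n) : J (Fin n) ℂ * (J (Fin n) ℂ * Z) = -Z := by
  rw [← mul_assoc, Matrix.J_squared, neg_one_mul]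

theorem sAdj_mul (X Y : CMat n) : sAdj (X * Y) = sAdj Y * sAdj X := by
  simp [sAdj, Matrix.transpose_mul, mul_assoc, J_mul_J_mul]

theorem sAdj_sAdj (X : CMat n) : sAdj (sAdj X) = X := by
  simp [sAdj, Matrix.transpose_mul, Matrix.J_transpose, Matrix.J_squared, mul_assoc, J_mul_J_mul]

theorem star_J : star (J (Fin n) ℂ) = -J (Fin n) ℂ := by
  simp [Matrix.star_eq_conjTranspose, Matrix.J, Matrix.fromBlocks_conjTranspose,
    Matrix.fromBlocks_neg]

theorem sAdj_star (X : CMat n) : sAdj (star X) = star (sAdj X) := by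
  have hX : (star X)ᵀ = star Xᵀ := rfl
  simp [sAdj, hX, star_J, mul_assoc]

/-- The symplectic adjoint as an anti-homomorphism of algebras. -/
def sAdjHom (n : ℕ) : CMat n →ₐ[ℂ] (CMat n)ᵐᵒᵖ :=
  .ofLinearMap
    { toFun X := .op (sAdj X)
      map_add' X Y := congrArg MulOpposite.op (sAdj_add X Y)
      map_smul' c X := congrArg MulOpposite.op (sAdj_smul c X) }
    (congrArg MulOpposite.op sAdj_one) fun X Y => congrArg MulOpposite.op (sAdj_mul X Y)

theorem sAdj_eq_unop_sAdjHom (X : CMat n) : sAdj X = (sAdjHom n X).unop := rfl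

theorem continuous_sAdj : Continuous (sAdj : CMat n → CMat n) := by
  unfold sAdj
  fun_prop

theorem sAdj_aeval (p : Polynomial ℂ) (X : CMat n) :
    sAdj (Polynomial.aeval X p) = Polynomial.aeval (sAdj X) p := by
  simp [sAdj_eq_unop_sAdjHom, Polynomial.aeval_eq_sum_range]

theorem sAdj_mem_unitaryGroup {Q : CMat n} (hQ : Q ∈ U2 n) : sAdj Q ∈ U2 n := by
  rw [Matrix.mem_unitaryGroup_iff, ← sAdj_star, ← sAdj_mul, Unitary.star_mul_self_of_mem hQ,
    sAdj_one]

theorem mul_sAdj_eq_one_iff (A : CMat n) : A * sAdj A = 1 ↔ A ∈ symplecticGroup (Fin n) ℂ := by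
  have hJ : IsUnit (J (Fin n) ℂ) := (Matrix.isUnit_iff_isUnit_det _).2 (isUnit_det_J (Fin n) ℂ)
  rw [SymplecticGroup.mem_iff, ← hJ.mul_left_inj]
  simp [sAdj, mul_assoc, Matrix.J_squared]

theorem sAdj_cayley {X : CMat n} (hX : IsUnit (1 + X)) : sAdj (cayley X) = cayley (sAdj X) :=
  unop_map_cayley (sAdjHom n).toRingHom hX

end SymplecticAdjoint

/-! ### Square roots -/

section SquareRoot

open Polynomial

theorem exists_polynomial_eval_mul_eval_eq {K : Type*} [Field K] [IsAlgClosed K] {s : Set K}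
    (hs : s.Finite) : ∃ p : K[X], ∀ z ∈ s, p.eval z * p.eval z = z := by
  classical
  choose r hr using IsAlgClosed.exists_eq_mul_self (k := K)
  refine ⟨Lagrange.interpolate hs.toFinset id r, fun z hz => ?_⟩
  have hz' := Lagrange.eval_interpolate_at_node r (Set.injOn_id _) (hs.mem_toFinset.2 hz)
  rw [id_eq] at hz'
  rw [hz', ← hr]

theorem exists_aeval_mem_unitary_mul_self_eq {A : Type*} [CStarAlgebra A] {u : A}
    (hu : u ∈ unitary A) (hfin : (spectrum ℂ u).Finite) :
    ∃ p : ℂ[X], aeval u p ∈ unitary A ∧ aeval u p * aeval u p = u := by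
  have hnormal : IsStarNormal u := isStarNormal_of_mem_unitary hu
  obtain ⟨p, hp⟩ := exists_polynomial_eval_mul_eval_eq hfin
  refine ⟨p, ?_, ?_⟩
  · rw [← cfc_polynomial p u, cfc_unitary_iff _ u hnormal p.continuous.continuousOn]
    intro z hz
    have hnorm : ‖p.eval z‖ * ‖p.eval z‖ = 1 := by
      rw [← norm_mul, hp z hz, spectrum.norm_eq_one_of_unitary (𝕜 := ℂ) hu hz]
    rw [Complex.star_def, Complex.conj_mul', sq, ← Complex.ofReal_mul, hnorm, Complex.ofReal_one]
  · rw [← map_mul, ← cfc_polynomial (p * p) u]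
    simp only [eval_mul]
    rw [cfc_congr (g := id) hp, cfc_id ℂ u]

end SquareRoot

section LocalSquareRoot

open scoped Topology

variable {A : Type*} [NormedRing A] [NormedAlgebra ℝ A]

/-- A smooth square root near `1`: a local inverse of `x ↦ x * x`. -/
structure IsLocalSqrt (r : A → A) : Prop where
  contDiffAt : ContDiffAt ℝ ω r 1
  map_one : r 1 = 1
  eventually_mul_self : ∀ᶠ y in 𝓝 (1 : A), r y * r y = y
  eventually_apply_mul_self : ∀ᶠ x in 𝓝 (1 : A), r (x * x) = x

theorem exists_isLocalSqrt [CompleteSpace A] : ∃ r : A → A, IsLocalSqrt r := by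
  let f : A → A := fun x => x * x
  have hf : ContDiffAt ℝ ω f 1 := contDiffAt_id.mul contDiffAt_id
  let two : A ≃L[ℝ] A := .smulLeft (Units.mk0 (2 : ℝ) two_ne_zero)
  have hf' : HasFDerivAt f (two : A →L[ℝ] A) 1 := by
    convert! (hasFDerivAt_id (𝕜 := ℝ) (1 : A)).mul' (hasFDerivAt_id (1 : A)) using 1
    ext x
    simp [two, two_smul, Units.smul_def]
  have hω : (ω : ℕ∞ω) ≠ 0 := by simp
  have hstrict := hf.hasStrictFDerivAt' hf' hω
  have hf1 : f 1 = 1 := mul_one 1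
  refine ⟨hf.localInverse hf' hω, ?_, ?_, ?_, ?_⟩
  · simpa only [hf1] using hf.to_localInverse hf' hω
  · simpa only [hf1] using hf.localInverse_apply_image hf' hω
  · have hright : ∀ᶠ y in 𝓝 (f 1), f (hf.localInverse hf' hω y) = y :=
      hstrict.eventually_right_inverse
    rwa [hf1] at hright
  · exact hstrict.eventually_left_inverse

variable {r : A → A}

theorem IsLocalSqrt.eventually_map_comm (hr : IsLocalSqrt r) {σ : A → A} (hσ : ContinuousAt σ 1)
    (hσ1 : σ 1 = 1) (hσ2 : ∀ x, σ (x * x) = σ x * σ x) :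
    ∀ᶠ y in 𝓝 (1 : A), r (σ y) = σ (r y) := by
  have hlim : Filter.Tendsto (fun y => σ (r y)) (𝓝 1) (𝓝 1) := by
    have := (hr.map_one.symm ▸ hσ : ContinuousAt σ (r 1)).comp hr.contDiffAt.continuousAt
    simpa only [ContinuousAt, Function.comp_apply, hr.map_one, hσ1, Function.comp_def] using this
  filter_upwards [hlim.eventually hr.eventually_apply_mul_self, hr.eventually_mul_self]
    with y hleft hright
  rw [← hleft, ← hσ2, hright]

theorem IsLocalSqrt.eventually_mem_unitary [CompleteSpace A] [StarRing A] [ContinuousStar A]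
    (hr : IsLocalSqrt r) : ∀ᶠ y in 𝓝 (1 : A), y ∈ unitary A → r y ∈ unitary A := by
  have hσ : ContinuousAt (fun x : A => Ring.inverse (star x)) 1 := by
    have hinv : ContinuousAt Ring.inverse (star (1 : A)) := by
      simpa only [star_one, Units.val_one] using NormedRing.inverse_continuousAt (1 : Aˣ)
    exact hinv.comp continuous_star.continuousAt
  have hcomm := hr.eventually_map_comm hσ (by simp) fun x => by
    rw [star_mul, Ring.mul_inverse_rev' (Commute.refl _)]
  filter_upwards [hcomm, hr.eventually_mul_self] with y hcomm hsq hy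
  have hyinv : Ring.inverse (star y) = y := Ring.inverse_unit (Unitary.toUnits ⟨y, hy⟩)⁻¹
  have hunit : IsUnit (r y) := by
    have hyunit : IsUnit (r y * r y) := hsq.symm ▸ ⟨Unitary.toUnits ⟨y, hy⟩, rfl⟩
    exact ((Commute.refl _).isUnit_mul_iff.1 hyunit).1
  rw [hyinv] at hcomm
  rw [hunit.mem_unitary_iff_star_mul_self]
  nth_rw 2 [hcomm]
  exact Ring.mul_inverse_cancel _ hunit.star

end LocalSquareRoot

/-! ### The matrices `Q Q^S` -/

section Squares

open scoped Matrix.Norms.L2Operator Topology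

variable {n : ℕ}

theorem squares_eq : squares n = {X : CMat n | X ∈ U2 n ∧ X = sAdj X} := by
  ext X
  constructor
  · rintro ⟨Q, hQ, rfl⟩
    exact ⟨mul_mem hQ (sAdj_mem_unitaryGroup hQ), by rw [sAdj_mul, sAdj_sAdj]⟩
  · rintro ⟨hX, hsymm⟩
    obtain ⟨p, hp, hp2⟩ := exists_aeval_mem_unitary_mul_self_eq hX (Matrix.finite_spectrum X)
    exact ⟨_, hp, by rw [sAdj_aeval, ← hsymm, hp2]⟩

/-- The tangent space at `1` of the set of symplectically symmetric unitary matrices. -/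
def skewSymm (n : ℕ) : Submodule ℝ (CMat n) :=
  skewAdjoint.submodule ℝ (CMat n) ⊓ (Y2 n).restrictScalars ℝ

theorem mem_squares_iff_cayley_mem_skewSymm {X : CMat n} (hX : IsUnit (1 + X)) :
    X ∈ squares n ↔ cayley X ∈ skewSymm n := by
  have hX' : IsUnit (1 + sAdj X) := by
    simpa [sAdj_eq_unop_sAdjHom] using (hX.map (sAdjHom n)).unop
  rw [squares_eq]
  refine and_congr (star_cayley_eq_neg_iff_mem_unitary isUnit_two hX).symm ?_
  change X = sAdj X ↔ cayley X = sAdj (cayley X)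
  rw [sAdj_cayley hX, cayley_inj isUnit_two hX hX']

theorem mul_mul_sAdj_mem_squares {P X : CMat n} (hP : P ∈ U2 n) (hX : X ∈ squares n) :
    P * X * sAdj P ∈ squares n := by
  obtain ⟨Q, hQ, rfl⟩ := hX
  exact ⟨P * Q, mul_mem hP hQ, by simp only [sAdj_mul, mul_assoc]⟩

theorem star_mul_mul_mul_sAdj_star {P : CMat n} (hP : P ∈ U2 n) (X : CMat n) :
    star P * (P * X * sAdj P) * sAdj (star P) = X := by
  have hP' : sAdj P * sAdj (star P) = 1 := by
    rw [← sAdj_mul, Unitary.star_mul_self_of_mem hP, sAdj_one]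
  rw [mul_assoc, mul_assoc _ _ (sAdj (star P)), hP', mul_one, ← mul_assoc,
    Unitary.star_mul_self_of_mem hP, one_mul]

theorem mul_mul_sAdj_mem_squares_iff {P X : CMat n} (hP : P ∈ U2 n) :
    P * X * sAdj P ∈ squares n ↔ X ∈ squares n := by
  refine ⟨fun h => ?_, mul_mul_sAdj_mem_squares hP⟩
  rw [← star_mul_mul_mul_sAdj_star hP X]
  exact mul_mul_sAdj_mem_squares (Unitary.star_mem hP) h

theorem isSliced_squares : IsSliced (squares n) (skewSymm n) := by
  refine isSliced_of_cayley (fun X => mem_squares_iff_cayley_mem_skewSymm) ?_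
  rintro _ ⟨Q, hQ, rfl⟩
  exact ⟨Unitary.toUnits ⟨Q, hQ⟩, Unitary.toUnits ⟨sAdj Q, sAdj_mem_unitaryGroup hQ⟩, rfl,
    fun _ => mul_mul_sAdj_mem_squares_iff hQ⟩

theorem IsLocalSqrt.eventually_mul_sAdj_eq {r : CMat n → CMat n} (hr : IsLocalSqrt r) :
    ∀ᶠ Y in 𝓝 (1 : CMat n), Y ∈ squares n → r Y ∈ U2 n ∧ r Y * sAdj (r Y) = Y := by
  filter_upwards [hr.eventually_mem_unitary, hr.eventually_mul_self, hr.eventually_map_comm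
    continuous_sAdj.continuousAt sAdj_one fun X => sAdj_mul X X] with Y hunitary hsq hcomm hY
  rw [squares_eq] at hY
  refine ⟨hunitary hY.1, ?_⟩
  rw [← hcomm, ← hY.2, hsq]

end Squares

/-! ### The homogeneous space -/

section Quotient

variable {n : ℕ}

/-- The map `[Q] ↦ Q Q^S` on the homogeneous space `U(2n)/Sp(n)`. -/
def quotSquare (n : ℕ) : U2 n ⧸ Sp n → CMat n :=
  Quotient.lift (fun Q : U2 n => (Q : CMat n) * sAdj Q) fun P Q h => by
    obtain ⟨A, rfl⟩ : ∃ A, Q = P * A := ⟨P⁻¹ * Q, by simp⟩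
    have hA : A ∈ Sp n := by simpa using QuotientGroup.leftRel_apply.1 h
    simp only [Submonoid.coe_mul, sAdj_mul]
    rw [mul_assoc, ← mul_assoc (A : CMat n), (mul_sAdj_eq_one_iff (A : CMat n)).2 hA, one_mul]

theorem quotSquare_mk (Q : U2 n) : quotSquare n (QuotientGroup.mk Q) = (Q : CMat n) * sAdj Q := rfl

theorem range_quotSquare : Set.range (quotSquare n) = squares n := by
  ext X
  simp [QuotientGroup.mk_surjective.exists, quotSquare_mk, squares, eq_comm]

theorem quotSquare_smul (A : U2 n) (q : U2 n ⧸ Sp n) :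
    quotSquare n (A • q) = (A : CMat n) * quotSquare n q * sAdj (A : CMat n) := by
  obtain ⟨Q, rfl⟩ := QuotientGroup.mk_surjective q
  change quotSquare n (QuotientGroup.mk (A * Q)) = _
  simp only [quotSquare_mk, Submonoid.coe_mul, sAdj_mul, mul_assoc]

theorem quotSquare_injective : Function.Injective (quotSquare n) := by
  intro p q h
  obtain ⟨P, rfl⟩ := QuotientGroup.mk_surjective p
  obtain ⟨Q, rfl⟩ := QuotientGroup.mk_surjective q
  have key : quotSquare n (P⁻¹ • (P : U2 n ⧸ Sp n)) = quotSquare n (P⁻¹ • (Q : U2 n ⧸ Sp n)) := by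
    rw [quotSquare_smul, h, quotSquare_smul]
  rw [QuotientGroup.eq]
  refine (mul_sAdj_eq_one_iff _).1 (key.symm.trans ?_)
  simp [quotSquare_mk, sAdj_one]

theorem isCompact_unitary {A : Type*} [NormedRing A] [StarRing A] [CStarRing A] [ProperSpace A] :
    IsCompact (unitary A : Set A) := by
  refine Metric.isCompact_of_isClosed_isBounded isClosed_unitary ?_
  refine Metric.isBounded_closedBall.subset (t := Metric.closedBall 0 1) fun u hu => ?_
  rw [mem_closedBall_zero_iff]
  nontriviality A
  exact (CStarRing.norm_of_mem_unitary hu).le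

open scoped Matrix.Norms.L2Operator in
theorem isEmbedding_quotSquare : Topology.IsEmbedding (quotSquare n) := by
  have hc : Continuous (quotSquare n) := continuous_quot_lift _
    (continuous_subtype_val.mul (continuous_sAdj.comp continuous_subtype_val))
  have : CompactSpace (U2 n) := isCompact_iff_compactSpace.1 isCompact_unitary
  exact (hc.isClosedEmbedding quotSquare_injective).isEmbedding

end Quotient

/-! ### Endomorphisms of `ℍ²ⁿ` -/

section Endomorphisms

open MulOpposite

variable {n : ℕ}

theorem inner_quaternion_mul_left (q x y : ℍ[ℝ]) : inner ℝ (q * x) y = inner ℝ x (star q * y) := by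
  simp only [Quaternion.inner_def, Quaternion.re_mul, Quaternion.imI_mul, Quaternion.imJ_mul,
    Quaternion.imK_mul, Quaternion.re_star, Quaternion.imI_star, Quaternion.imJ_star,
    Quaternion.imK_star]
  ring

theorem inner_quaternion_mul_right (x q y : ℍ[ℝ]) :
    inner ℝ (x * q) y = inner ℝ x (y * star q) := by
  simp [Quaternion.inner_def, mul_assoc]

/-- The action of complex matrices on `ℍ²ⁿ` as a homomorphism of real algebras. -/
def actHom (n : ℕ) : CMat n →ₐ[ℝ] Module.End ℍ[ℝ]ᵐᵒᵖ (HVec n) :=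
  .ofLinearMap
    { toFun := act
      map_add' A B := by
        ext1 x
        ext1 a
        simp [act_apply, add_mul, Finset.sum_add_distrib]
      map_smul' c A := by
        have hc (z : ℂ) : ((c • z : ℂ) : ℍ[ℝ]) = c • (z : ℍ[ℝ]) := map_smul Quaternion.ofComplex c z
        ext1 x
        ext1 a
        simp only [act_apply, Matrix.smul_apply, hc, smul_mul_assoc, RingHom.id_apply,
          LinearMap.smul_apply, PiLp.smul_apply, Finset.smul_sum] }
    act_one act_mul

theorem actHom_apply (A : CMat n) (x : HVec n) : actHom n A x = act A x := rfl

theorem actHom_apply_single (A : CMat n) (a b : Fin n ⊕ Fin n) :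
    actHom n A (PiLp.single 2 b 1) a = ((A a b : ℂ) : ℍ[ℝ]) := by
  simp [actHom_apply, act_apply]

theorem actHom_injective : Function.Injective (actHom n) := by
  intro A B h
  ext a b
  have hab : ((A a b : ℂ) : ℍ[ℝ]) = ((B a b : ℂ) : ℍ[ℝ]) := by
    rw [← actHom_apply_single, h, actHom_apply_single]
  exact Complex.ext (by simpa using congrArg (·.re) hab) (by simpa using congrArg (·.imI) hab)

theorem inner_actHom (A : CMat n) (x y : HVec n) :
    inner ℝ (actHom n A x) y = inner ℝ x (actHom n (star A) y) := by
  simp only [actHom_apply, PiLp.inner_apply, act_apply, sum_inner, inner_sum]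
  rw [Finset.sum_comm]
  simp only [inner_quaternion_mul_left, Matrix.star_apply, coe_star]

theorem eq_sum_op_smul_single (x : HVec n) : x = ∑ b, op (x b) • PiLp.single 2 b 1 := by
  ext1 a
  simp [Pi.single_apply, -Fintype.sum_sum_type]

/-- The quaternion unit `j`. -/
@[simps]
def quatJ : ℍ[ℝ] := ⟨0, 0, 1, 0⟩

theorem quatJ_mul_self : quatJ * quatJ = -1 := by
  ext <;> simp

theorem star_quatJ : star quatJ = -quatJ := by
  ext <;> simp

theorem quatJ_mul_coe (z : ℂ) : quatJ * (z : ℍ[ℝ]) = ((star z : ℂ) : ℍ[ℝ]) * quatJ := by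
  ext <;> simp

theorem eq_coe_add_coe_mul_quatJ (q : ℍ[ℝ]) :
    q = ((⟨q.re, q.imI⟩ : ℂ) : ℍ[ℝ]) + ((⟨q.imJ, q.imK⟩ : ℂ) : ℍ[ℝ]) * quatJ := by
  ext <;> simp

/-- Multiplication by `j` from the left. -/
def jMul (n : ℕ) : Module.End ℍ[ℝ]ᵐᵒᵖ (HVec n) where
  toFun x := WithLp.toLp 2 fun a => quatJ * x a
  map_add' x y := by
    ext1 a
    simp [mul_add]
  map_smul' c x := by
    ext1 a
    simp [mul_assoc]

theorem jMul_apply (x : HVec n) (a : Fin n ⊕ Fin n) : jMul n x a = quatJ * x a := rfl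

theorem jMul_mul_jMul : jMul n * jMul n = -1 := by
  ext1 x
  ext1 a
  simp [jMul_apply, ← mul_assoc, quatJ_mul_self]

theorem jMul_mul_actHom (A : CMat n) : jMul n * actHom n A = actHom n (A.map star) * jMul n := by
  ext1 x
  ext1 a
  simp only [Module.End.mul_apply, jMul_apply, actHom_apply, act_apply, Finset.mul_sum,
    Matrix.map_apply, ← mul_assoc, quatJ_mul_coe]

theorem inner_jMul (x y : HVec n) : inner ℝ (jMul n x) y = -inner ℝ x (jMul n y) := by
  simp [PiLp.inner_apply, jMul_apply, inner_quaternion_mul_left, star_quatJ, -Fintype.sum_sum_type]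

theorem exists_eq_actHom_add_actHom_mul_jMul (M : Module.End ℍ[ℝ]ᵐᵒᵖ (HVec n)) :
    ∃ A B : CMat n, M = actHom n A + actHom n B * jMul n := by
  let m (a b : Fin n ⊕ Fin n) : ℍ[ℝ] := M (PiLp.single 2 b 1) a
  refine ⟨.of fun a b => ⟨(m a b).re, (m a b).imI⟩, .of fun a b => ⟨(m a b).imJ, (m a b).imK⟩, ?_⟩
  ext1 x
  ext1 a
  have hM : M x a = ∑ b, m a b * x b := by
    conv_lhs => rw [eq_sum_op_smul_single x]
    simp [m, -Fintype.sum_sum_type]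
  simp only [hM, LinearMap.add_apply, Module.End.mul_apply, PiLp.add_apply, actHom_apply, act_apply,
    jMul_apply, Matrix.of_apply, ← Finset.sum_add_distrib, ← mul_assoc, ← add_mul,
    ← eq_coe_add_coe_mul_quatJ]

end Endomorphisms

section ConjAct

variable {n : ℕ}

/-- The reflection `x ↦ -J j x` of `ℍ²ⁿ`, whose fixed space is the Lagrangian subspace corresponding
to the unit matrix. -/
def baseReflection (n : ℕ) : Module.End ℍ[ℝ]ᵐᵒᵖ (HVec n) := actHom n (-J (Fin n) ℂ) * jMul n

theorem J_map_star : (J (Fin n) ℂ).map star = J (Fin n) ℂ := by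
  change (star (J (Fin n) ℂ))ᵀ = _
  rw [star_J, transpose_neg, J_transpose, neg_neg]

theorem baseReflection_mul_self : baseReflection n * baseReflection n = 1 := by
  have hJ : (-J (Fin n) ℂ).map star = -J (Fin n) ℂ := by
    rw [Matrix.map_neg _ star_neg, J_map_star]
  calc baseReflection n * baseReflection n
      = actHom n (-J (Fin n) ℂ) * (jMul n * actHom n (-J (Fin n) ℂ)) * jMul n := by
        simp only [baseReflection, mul_assoc]
    _ = actHom n (-J (Fin n) ℂ * -J (Fin n) ℂ) * (jMul n * jMul n) := by
        rw [jMul_mul_actHom, hJ, map_mul]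
        simp only [mul_assoc]
    _ = 1 := by simp [jMul_mul_jMul, Matrix.J_squared]

theorem baseReflection_mul_actHom (A : CMat n) :
    baseReflection n * actHom n A = actHom n (sAdj (star A)) * baseReflection n := by
  have hA : A.map star = (star A)ᵀ := rfl
  rw [baseReflection, mul_assoc, jMul_mul_actHom, ← mul_assoc, ← mul_assoc, ← map_mul, ← map_mul,
    hA, sAdj]
  simp [mul_assoc, Matrix.J_squared]

theorem inner_baseReflection (x y : HVec n) :
    inner ℝ (baseReflection n x) y = inner ℝ x (baseReflection n y) := by
  have hcomm := LinearMap.congr_fun (jMul_mul_actHom (J (Fin n) ℂ)) y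
  rw [J_map_star, Module.End.mul_apply, Module.End.mul_apply] at hcomm
  rw [baseReflection, Module.End.mul_apply, Module.End.mul_apply, inner_actHom, star_neg, star_J,
    neg_neg, inner_jMul, hcomm, map_neg, LinearMap.neg_apply, inner_neg_right]

/-- Multiplication by `i` from the left. -/
def iMul (n : ℕ) : Module.End ℍ[ℝ]ᵐᵒᵖ (HVec n) := actHom n (Complex.I • 1)

theorem iMul_mul_iMul : iMul n * iMul n = -1 := by
  simp [iMul, ← map_mul, smul_smul]

/-- The endomorphisms of `ℍ²ⁿ` which anticommute with `i`, in terms of complex matrices; the matrix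
`1` corresponds to `baseReflection`. -/
def conjAct (n : ℕ) : CMat n →ₗ[ℝ] Module.End ℍ[ℝ]ᵐᵒᵖ (HVec n) :=
  LinearMap.mulRight ℝ (baseReflection n) ∘ₗ (actHom n).toLinearMap

theorem conjAct_apply (X : CMat n) : conjAct n X = actHom n X * baseReflection n := rfl

theorem conjAct_injective : Function.Injective (conjAct n) := by
  intro X Y h
  have h' := congrArg (· * baseReflection n) h
  simp only [conjAct_apply, mul_assoc, baseReflection_mul_self, mul_one] at h'
  exact actHom_injective h'

theorem actHom_mul_conjAct (A X : CMat n) : actHom n A * conjAct n X = conjAct n (A * X) := by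
  rw [conjAct_apply, conjAct_apply, map_mul, mul_assoc]

theorem conjAct_mul_actHom (X A : CMat n) :
    conjAct n X * actHom n A = conjAct n (X * sAdj (star A)) := by
  rw [conjAct_apply, mul_assoc, baseReflection_mul_actHom, ← mul_assoc, ← map_mul, conjAct_apply]

theorem conjAct_mul_conjAct (X Y : CMat n) :
    conjAct n X * conjAct n Y = actHom n (X * sAdj (star Y)) := by
  rw [conjAct_apply Y, ← mul_assoc, conjAct_mul_actHom, conjAct_apply, mul_assoc,
    baseReflection_mul_self, mul_one]

theorem inner_conjAct (X : CMat n) (x y : HVec n) :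
    inner ℝ (conjAct n X x) y = inner ℝ x (conjAct n (sAdj X) y) := by
  have h := LinearMap.congr_fun (baseReflection_mul_actHom (star X)) y
  rw [star_star] at h
  rw [conjAct_apply, conjAct_apply, ← h]
  simp only [Module.End.mul_apply, inner_actHom, inner_baseReflection]

theorem conjAct_mul_iMul (X : CMat n) : conjAct n X * iMul n = -(iMul n * conjAct n X) := by
  have hI : star (Complex.I • (1 : CMat n)) = (-Complex.I) • 1 := by simp
  rw [iMul, conjAct_mul_actHom, actHom_mul_conjAct, hI, sAdj_smul, sAdj_one, ← map_neg]
  simp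

theorem exists_eq_actHom_add_conjAct (M : Module.End ℍ[ℝ]ᵐᵒᵖ (HVec n)) :
    ∃ A B : CMat n, M = actHom n A + conjAct n B := by
  obtain ⟨A, B, rfl⟩ := exists_eq_actHom_add_actHom_mul_jMul M
  refine ⟨A, B * J (Fin n) ℂ, ?_⟩
  rw [conjAct_apply, baseReflection, ← mul_assoc, ← map_mul]
  simp [mul_assoc, Matrix.J_squared]

theorem exists_conjAct_eq {M : Module.End ℍ[ℝ]ᵐᵒᵖ (HVec n)}
    (hM : M * iMul n = -(iMul n * M)) : ∃ X : CMat n, conjAct n X = M := by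
  obtain ⟨A, B, rfl⟩ := exists_eq_actHom_add_conjAct M
  rw [add_mul, mul_add, conjAct_mul_iMul, neg_add, add_left_inj, iMul, ← map_mul, ← map_mul,
    ← map_neg] at hM
  have : IsAddTorsionFree (CMat n) := .of_module_rat _
  have hA : Complex.I • A = 0 := self_eq_neg.1 (by simpa using actHom_injective hM)
  rw [smul_eq_zero_iff_right Complex.I_ne_zero] at hA
  exact ⟨B, by rw [hA, map_zero, zero_add]⟩

theorem mem_squares_iff_conjAct {X : CMat n} : X ∈ squares n ↔
    conjAct n X * conjAct n X = 1 ∧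
      ∀ x y, inner ℝ (conjAct n X x) y = inner ℝ x (conjAct n X y) := by
  have hsymm : (∀ x y, inner ℝ (conjAct n X x) y = inner ℝ x (conjAct n X y)) ↔ X = sAdj X := by
    simp_rw [inner_conjAct]
    refine ⟨fun h => conjAct_injective ?_, fun h _ _ => by rw [← h]⟩
    exact LinearMap.ext fun y => ext_inner_left ℝ fun x => (h x y).symm
  rw [squares_eq, hsymm, Set.mem_ofPred_eq]
  refine and_congr_left fun h => ?_
  rw [conjAct_mul_conjAct, sAdj_star, ← h, Matrix.mem_unitaryGroup_iff, ← map_one (actHom n),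
    actHom_injective.eq_iff]

end ConjAct

/-! ### Lagrangian subspaces -/

section Lagrangian

open MulOpposite

theorem forall_mem_iff_apply_mem_orthogonal_iff {E : Type*} [NormedAddCommGroup E]
    [InnerProductSpace ℝ E] {K : Submodule ℝ E} [K.HasOrthogonalProjection] {T : E →ₗ[ℝ] E}
    (hT : ∀ x, T (T x) = -x) :
    (∀ x, x ∈ K ↔ T x ∈ Kᗮ) ↔ ∀ x, K.reflection (T x) = -T (K.reflection x) := by
  have hTinj : Function.Injective T := fun x y h => by
    rw [← neg_inj, ← hT, h, hT]
  have hmem (x : E) : x ∈ Kᗮ ↔ K.reflection x = -x := by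
    rw [← Submodule.reflection_eq_self_iff, Submodule.reflection_orthogonal_apply,
      neg_eq_iff_eq_neg]
  constructor
  · intro h x
    have hK (y : E) (hy : y ∈ K) : K.reflection (T y) = -T y := (hmem _).1 ((h y).1 hy)
    have hKo (z : E) (hz : z ∈ Kᗮ) : K.reflection (T z) = T z := by
      rw [Submodule.reflection_eq_self_iff, h, hT]
      exact neg_mem hz
    obtain ⟨y, hy, z, hz, rfl⟩ := K.exists_add_mem_mem_orthogonal x
    simp only [map_add, hK y hy, hKo z hz, (hmem z).1 hz,
      Submodule.reflection_mem_subspace_eq_self hy, map_neg, neg_add, neg_neg]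
  · intro h x
    rw [hmem, h, neg_inj, hTinj.eq_iff, Submodule.reflection_eq_self_iff]

variable {n : ℕ}

theorem inner_op_smul (q : ℍ[ℝ]) (x y : HVec n) :
    inner ℝ (op q • x) y = inner ℝ x (op (star q) • y) := by
  simp [PiLp.inner_apply, inner_quaternion_mul_right, -Fintype.sum_sum_type]

theorem re_skewForm (x y : HVec n) : (skewForm x y).re = -inner ℝ y (iMul n x) := by
  have hi (a : Fin n ⊕ Fin n) : iMul n x a = ((Complex.I : ℂ) : ℍ[ℝ]) * x a := by
    simp [iMul, actHom_apply, act_apply, -Fintype.sum_sum_type, Matrix.one_apply,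
      apply_ite Quaternion.coeComplex]
  have hsum (f : Fin n ⊕ Fin n → ℍ[ℝ]) : (∑ a, f a).re = ∑ a, (f a).re :=
    map_sum (⟨⟨fun q => q.re, rfl⟩, fun _ _ => rfl⟩ : ℍ[ℝ] →+ ℝ) f Finset.univ
  simp only [skewForm, PiLp.inner_apply, hi, hsum, ← Finset.sum_neg_distrib]
  refine Finset.sum_congr rfl fun a _ => ?_
  simp [Quaternion.inner_def]
  ring

theorem skewForm_op_smul (x y : HVec n) (q : ℍ[ℝ]) : skewForm x (op q • y) = skewForm x y * q := by
  simp [skewForm, Finset.sum_mul, mul_assoc, -Fintype.sum_sum_type]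

theorem forall_skewForm_eq_zero_iff (W : Submodule ℍ[ℝ]ᵐᵒᵖ (HVec n)) (x : HVec n) :
    (∀ y ∈ W, skewForm x y = 0) ↔ iMul n x ∈ (W.restrictScalars ℝ)ᗮ := by
  rw [Submodule.mem_orthogonal]
  refine ⟨fun h y hy => ?_, fun h y hy => ?_⟩
  · rw [← neg_eq_zero, ← re_skewForm, h y hy, Quaternion.re_zero]
  · have hre := h _ (W.smul_mem (op (star (skewForm x y))) hy)
    rw [← neg_eq_zero, ← re_skewForm, skewForm_op_smul, Quaternion.self_mul_star,
      Quaternion.re_coe] at hre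
    exact Quaternion.normSq_eq_zero.1 hre

/-- The reflection of `ℍ²ⁿ` in a quaternionic subspace. -/
def reflection (W : Submodule ℍ[ℝ]ᵐᵒᵖ (HVec n)) : Module.End ℍ[ℝ]ᵐᵒᵖ (HVec n) where
  toFun := (W.restrictScalars ℝ).reflection
  map_add' := map_add _
  map_smul' c x := by
    let K := W.restrictScalars ℝ
    have hproj : K.starProjection (c • x) = c • K.starProjection x := by
      refine Submodule.eq_starProjection_of_mem_of_inner_eq_zero
        (W.smul_mem c (K.starProjection_apply_mem x)) fun y hy => ?_
      rw [← smul_sub, ← op_unop c, inner_op_smul]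
      exact K.starProjection_inner_eq_zero x _ (W.smul_mem _ hy)
    simp only [Submodule.reflection_apply, RingHom.id_apply, smul_sub, smul_comm c 2]
    exact congrArg (2 • · - c • x) hproj

theorem inner_reflection (W : Submodule ℍ[ℝ]ᵐᵒᵖ (HVec n)) (x y : HVec n) :
    inner ℝ (reflection W x) y = inner ℝ x (reflection W y) := by
  let σ := (W.restrictScalars ℝ).reflection
  calc inner ℝ (σ x) y = inner ℝ (σ x) (σ (σ y)) := by rw [Submodule.reflection_reflection]
    _ = inner ℝ x (σ y) := σ.inner_map_map x (σ y)

theorem isLagrangian_iff_reflection_mul_iMul {W : Submodule ℍ[ℝ]ᵐᵒᵖ (HVec n)} :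
    IsLagrangian W ↔ reflection W * iMul n = -(iMul n * reflection W) := by
  rw [IsLagrangian]
  simp_rw [forall_skewForm_eq_zero_iff]
  rw [LinearMap.ext_iff]
  exact forall_mem_iff_apply_mem_orthogonal_iff (K := W.restrictScalars ℝ)
    (T := (iMul n).restrictScalars ℝ) (LinearMap.congr_fun iMul_mul_iMul)

theorem exists_reflection_eq {R : Module.End ℍ[ℝ]ᵐᵒᵖ (HVec n)} (hR : R * R = 1)
    (hsymm : ∀ x y, inner ℝ (R x) y = inner ℝ x (R y)) : ∃ W, reflection W = R := by
  let W : Submodule ℍ[ℝ]ᵐᵒᵖ (HVec n) := LinearMap.eqLocus R 1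
  have hRR (x : HVec n) : R (R x) = x := LinearMap.congr_fun hR x
  have hproj (x : HVec n) :
      (W.restrictScalars ℝ).starProjection x = (1 / 2 : ℝ) • (x + R x) := by
    refine Submodule.eq_starProjection_of_mem_of_inner_eq_zero ?_ fun y hy => ?_
    · change R _ = _
      rw [LinearMap.map_smul_of_tower, map_add, hRR, add_comm, Module.End.one_apply]
    · have hy' : R y = y := hy
      have hz : x - (1 / 2 : ℝ) • (x + R x) = (1 / 2 : ℝ) • (x - R x) := by module
      rw [hz, real_inner_smul_left, inner_sub_left, hsymm, hy', sub_self, mul_zero]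
  refine ⟨W, LinearMap.ext fun x => ?_⟩
  change (W.restrictScalars ℝ).reflection x = R x
  rw [Submodule.reflection_apply, hproj]
  module

theorem proj_apply (W : LGr n) (x : HVec n) :
    proj W x = (1 / 2 : ℝ) • (x + reflection W.1 x) := by
  change _ = (1 / 2 : ℝ) • (x + (W.1.restrictScalars ℝ).reflection x)
  rw [Submodule.reflection_apply, proj]
  module

theorem reflection_injective :
    Function.Injective (reflection : Submodule ℍ[ℝ]ᵐᵒᵖ (HVec n) → _) := by
  intro V W h
  ext x
  have hmem (U : Submodule ℍ[ℝ]ᵐᵒᵖ (HVec n)) : x ∈ U ↔ reflection U x = x :=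
    ((U.restrictScalars ℝ).reflection_eq_self_iff x).symm
  rw [hmem, hmem, h]

theorem range_reflection_LGr :
    Set.range (fun W : LGr n => reflection W.1) = conjAct n '' squares n := by
  ext R
  constructor
  · rintro ⟨W, rfl⟩
    obtain ⟨X, hX⟩ := exists_conjAct_eq (isLagrangian_iff_reflection_mul_iMul.1 W.2)
    refine ⟨X, mem_squares_iff_conjAct.2 ?_, hX⟩
    rw [hX]
    exact ⟨LinearMap.ext (W.1.restrictScalars ℝ).reflection_reflection, inner_reflection W.1⟩
  · rintro ⟨X, hX, rfl⟩
    obtain ⟨hsq, hsymm⟩ := mem_squares_iff_conjAct.1 hX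
    obtain ⟨W, hW⟩ := exists_reflection_eq hsq hsymm
    refine ⟨⟨W, isLagrangian_iff_reflection_mul_iMul.2 ?_⟩, hW⟩
    rw [hW, conjAct_mul_iMul]

theorem reflection_map_actHom (A : U2 n) (W : Submodule ℍ[ℝ]ᵐᵒᵖ (HVec n)) :
    reflection (W.map (actHom n A)) =
      actHom n A * reflection W * actHom n (star (A : CMat n)) := by
  let f : HVec n ≃ₗᵢ[ℝ] HVec n := LinearEquiv.isometryOfInner
    (.ofLinearMap ((actHom n A).restrictScalars ℝ)
      ((actHom n (star (A : CMat n))).restrictScalars ℝ)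
      (LinearMap.ext (act_act_star A)) (LinearMap.ext (act_star_act A)))
    fun x y => (inner_actHom _ _ _).trans (congrArg (inner ℝ x) (act_star_act A y))
  exact LinearMap.ext (Submodule.reflection_map_apply f (W.restrictScalars ℝ))

theorem conjAct_eq_reflection_smul {X : CMat n} {W : LGr n} (h : conjAct n X = reflection W.1)
    (A : U2 n) : conjAct n (A * X * sAdj (A : CMat n)) = reflection (A • W).1 := by
  change _ = reflection (W.1.map (actHom n A))
  rw [reflection_map_actHom, ← h, actHom_mul_conjAct, conjAct_mul_actHom, star_star]

/-- The affine parametrization of the projections onto Lagrangian subspaces by `squares n`, sending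
a matrix to the operator `(1 + R) / 2`, where `R` is the corresponding reflection. -/
def lagrangianProj (n : ℕ) : CMat n →ᵃ[ℝ] (HVec n →L[ℝ] HVec n) :=
  ((1 / 2 : ℝ) • (LinearMap.toContinuousLinearMap.toLinearMap ∘ₗ
    LinearMap.restrictScalarsₗ ℝ ℍ[ℝ]ᵐᵒᵖ (HVec n) (HVec n) ℝ ∘ₗ conjAct n)).toAffineMap +
    AffineMap.const ℝ (CMat n) ((1 / 2 : ℝ) • 1)

theorem lagrangianProj_apply (X : CMat n) (x : HVec n) :
    lagrangianProj n X x = (1 / 2 : ℝ) • (x + conjAct n X x) := by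
  rw [smul_add, add_comm]
  rfl

theorem lagrangianProj_eq_proj_iff {X : CMat n} {W : LGr n} :
    lagrangianProj n X = proj W ↔ conjAct n X = reflection W.1 := by
  simp [ContinuousLinearMap.ext_iff, LinearMap.ext_iff, lagrangianProj_apply, proj_apply]

theorem lagrangianProj_injective : Function.Injective (lagrangianProj n) := by
  refine fun X Y h => conjAct_injective (LinearMap.ext fun x => ?_)
  simpa [lagrangianProj_apply] using DFunLike.congr_fun h x

theorem proj_injective : Function.Injective (proj : LGr n → HVec n →L[ℝ] HVec n) := by
  refine fun V W h => Subtype.ext (reflection_injective (LinearMap.ext fun x => ?_))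
  simpa [proj_apply] using DFunLike.congr_fun h x

theorem range_proj :
    Set.range (proj : LGr n → HVec n →L[ℝ] HVec n) = lagrangianProj n '' squares n := by
  ext P
  constructor
  · rintro ⟨W, rfl⟩
    obtain ⟨X, hX, h⟩ := range_reflection_LGr.subset ⟨W, rfl⟩
    exact ⟨X, hX, lagrangianProj_eq_proj_iff.2 h⟩
  · rintro ⟨X, hX, rfl⟩
    obtain ⟨W, h⟩ := range_reflection_LGr.superset ⟨X, hX, rfl⟩
    exact ⟨W, (lagrangianProj_eq_proj_iff.2 h.symm).symm⟩

theorem isEmbedding_proj : Topology.IsEmbedding (proj : LGr n → HVec n →L[ℝ] HVec n) :=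
  ⟨⟨rfl⟩, proj_injective⟩

end Lagrangian

/-! ### Smooth structures -/

section SmoothEmbedding

variable {𝕜 : Type*} [NontriviallyNormedField 𝕜]
  {E₁ E₂ E₃ : Type*} [NormedAddCommGroup E₁] [NormedSpace 𝕜 E₁]
  [NormedAddCommGroup E₂] [NormedSpace 𝕜 E₂] [NormedAddCommGroup E₃] [NormedSpace 𝕜 E₃]
  {H₁ H₂ H₃ : Type*} [TopologicalSpace H₁] [TopologicalSpace H₂] [TopologicalSpace H₃]
  {I₁ : ModelWithCorners 𝕜 E₁ H₁} {I₂ : ModelWithCorners 𝕜 E₂ H₂} {I₃ : ModelWithCorners 𝕜 E₃ H₃}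
  {M N P : Type*} [TopologicalSpace M] [ChartedSpace H₁ M] [TopologicalSpace N] [ChartedSpace H₂ N]
  [TopologicalSpace P] [ChartedSpace H₃ P] {m : ℕ∞ω} {f : M → N} {φ : N → P}

theorem contMDiffOn_of_isSmoothEmbedding_comp (hφ : IsSmoothEmbedding I₂ I₃ m φ) {V : Set M}
    (hV : IsOpen V) (h : ContMDiffOn I₁ I₃ m (φ ∘ f) V) : ContMDiffOn I₁ I₂ m f V := by
  have hc : ContinuousOn f V := hφ.isEmbedding.continuousOn_iff.2 h.continuousOn
  intro x hx
  have hVx := hV.mem_nhds hx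
  exact ((ContMDiffAt.iff_comp_isImmersionAt (hφ.isImmersion.isImmersionAt (f x))).2
    ⟨hc.continuousAt hVx, h.contMDiffAt hVx⟩).contMDiffWithinAt

theorem contMDiff_of_isSmoothEmbedding_comp (hφ : IsSmoothEmbedding I₂ I₃ m φ)
    (h : ContMDiff I₁ I₃ m (φ ∘ f)) : ContMDiff I₁ I₂ m f :=
  contMDiffOn_univ.1 (contMDiffOn_of_isSmoothEmbedding_comp hφ isOpen_univ h.contMDiffOn)

end SmoothEmbedding

section AffineMap

variable {E : Type*} [NormedAddCommGroup E] [NormedSpace ℝ E] {E' : Type*} [NormedAddCommGroup E']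
  [NormedSpace ℝ E']

theorem contDiff_affineMap [FiniteDimensional ℝ E] (i : E →ᵃ[ℝ] E') {m : ℕ∞ω} : ContDiff ℝ m i :=
  (⟨i, i.continuous_of_finiteDimensional⟩ : E →ᴬ[ℝ] E').contDiff

theorem exists_contDiff_leftInverse [FiniteDimensional ℝ E'] {i : E →ᵃ[ℝ] E'}
    (hi : Function.Injective i) : ∃ g : E' → E, ContDiff ℝ ∞ g ∧ Function.LeftInverse g i := by
  obtain ⟨l, hl⟩ := i.linear.exists_leftInverse_of_injective
    (LinearMap.ker_eq_bot.2 (i.linear_injective_iff.2 hi))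
  refine ⟨fun y => l (y - i 0), (LinearMap.toContinuousLinearMap l).contDiff.comp
    (contDiff_id.sub contDiff_const), fun x => ?_⟩
  rw [i.decomp]
  simpa using LinearMap.congr_fun hl x

end AffineMap

section Entries

open scoped Matrix.Norms.L2Operator

variable {n : ℕ}

/-- Taking the array of entries, as a continuous linear equivalence for the operator norm. -/
def entriesCLE (n : ℕ) : CMat n ≃L[ℝ] Entries n :=
  (LinearEquiv.refl ℝ (Entries n)).toContinuousLinearEquiv

theorem isEmbedding_entries : Topology.IsEmbedding (entries : CMat n → Entries n) :=
  (entriesCLE n).toHomeomorph.isEmbedding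

theorem isSliced_unitaryGroup :
    IsSliced (U2 n : Set (CMat n)) (skewAdjoint.submodule ℝ (CMat n)) :=
  isSliced_unitary

theorem IsSliced.exists_chartedSpace_entries {S : Set (CMat n)} {F : Submodule ℝ (CMat n)}
    (hS : IsSliced S F) {M : Type*} [TopologicalSpace M] {f : M → CMat n}
    (hf : Topology.IsEmbedding f) (hr : Set.range f = S) :
    ∃ _ : ChartedSpace (EuclideanSpace ℝ (Fin (Module.finrank ℝ F))) M,
      IsManifold (𝓡 (Module.finrank ℝ F)) ∞ M ∧
        IsSmoothEmbedding (𝓡 (Module.finrank ℝ F)) 𝓘(ℝ, Entries n) ∞ fun x => entries (f x) := by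
  subst hr
  let i : CMat n →ᵃ[ℝ] Entries n := (entriesCLE n).toLinearMap.toAffineMap
  have hi : Function.Injective i := (entriesCLE n).injective
  exact hS.exists_chartedSpace_of_range_eq_image hi (isEmbedding_entries.comp hf)
    (Set.range_comp i f)

theorem exists_chartedSpace_LGr (n : ℕ) :
    ∃ _ : ChartedSpace (EuclideanSpace ℝ (Fin (Module.finrank ℝ (skewSymm n)))) (LGr n),
      IsManifold (𝓡 (Module.finrank ℝ (skewSymm n))) ∞ (LGr n) ∧
        IsSmoothEmbedding (𝓡 (Module.finrank ℝ (skewSymm n))) 𝓘(ℝ, HVec n →L[ℝ] HVec n) ∞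
          (proj : LGr n → HVec n →L[ℝ] HVec n) :=
  isSliced_squares.exists_chartedSpace_of_range_eq_image (i := lagrangianProj n)
    lagrangianProj_injective isEmbedding_proj range_proj

variable {E : Type*} [NormedAddCommGroup E] [NormedSpace ℝ E] {H : Type*} [TopologicalSpace H]
  {I : ModelWithCorners ℝ E H} {M : Type*} [TopologicalSpace M] [ChartedSpace H M]
  {m : ℕ∞ω} {f : M → CMat n}

theorem contMDiffOn_entries_comp_iff {V : Set M} :
    ContMDiffOn I 𝓘(ℝ, Entries n) m (fun x => entries (f x)) V ↔
      ContMDiffOn I 𝓘(ℝ, CMat n) m f V :=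
  ⟨fun h => (entriesCLE n).symm.contDiff.contMDiff.comp_contMDiffOn h,
    fun h => (entriesCLE n).contDiff.contMDiff.comp_contMDiffOn h⟩

theorem contMDiff_entries_comp_iff :
    ContMDiff I 𝓘(ℝ, Entries n) m (fun x => entries (f x)) ↔ ContMDiff I 𝓘(ℝ, CMat n) m f := by
  rw [← contMDiffOn_univ, contMDiffOn_entries_comp_iff, contMDiffOn_univ]

end Entries

section SmoothQuotient

open scoped Matrix.Norms.L2Operator Topology

variable {n : ℕ}

theorem contDiff_sAdj {m : ℕ∞ω} : ContDiff ℝ m (sAdj : CMat n → CMat n) :=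
  (LinearMap.toContinuousLinearMap
    { toFun := sAdj
      map_add' := sAdj_add
      map_smul' := fun c X => sAdj_smul (c : ℂ) X : CMat n →ₗ[ℝ] CMat n }).contDiff

theorem exists_contDiffOn_section_squares (n : ℕ) :
    ∃ (r : CMat n → CMat n) (V : Set (CMat n)), IsOpen V ∧ 1 ∈ V ∧ ContDiffOn ℝ ∞ r V ∧
      ∀ Y ∈ V, Y ∈ squares n → r Y ∈ U2 n ∧ r Y * sAdj (r Y) = Y := by
  obtain ⟨r, hr⟩ := exists_isLocalSqrt (A := CMat n)
  obtain ⟨V, hV, hVo, h1⟩ := eventually_nhds_iff.1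
    ((hr.contDiffAt.eventually (by simp)).and hr.eventually_mul_sAdj_eq)
  exact ⟨r, V, hVo, h1, fun Y hY => ((hV Y hY).1.of_le le_top).contDiffWithinAt,
    fun Y hY => (hV Y hY).2⟩

variable {k d : ℕ} [ChartedSpace (EuclideanSpace ℝ (Fin k)) (U2 n)]
  [ChartedSpace (EuclideanSpace ℝ (Fin d)) (U2 n ⧸ Sp n)]

theorem contMDiff_mk
    (hU : IsSmoothEmbedding (𝓡 k) 𝓘(ℝ, Entries n) ∞ fun Q : U2 n => entries (Q : CMat n))
    (hG : IsSmoothEmbedding (𝓡 d) 𝓘(ℝ, Entries n) ∞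
      fun q : U2 n ⧸ Sp n => entries (quotSquare n q)) :
    ContMDiff (𝓡 k) (𝓡 d) ∞ (QuotientGroup.mk : U2 n → U2 n ⧸ Sp n) := by
  refine contMDiff_of_isSmoothEmbedding_comp hG (contMDiff_entries_comp_iff.2 ?_)
  exact (contDiff_id.mul contDiff_sAdj).contMDiff.comp (contMDiff_entries_comp_iff.1 hU.contMDiff)

theorem exists_contMDiffOn_section
    (hU : IsSmoothEmbedding (𝓡 k) 𝓘(ℝ, Entries n) ∞ fun Q : U2 n => entries (Q : CMat n))
    (hG : IsSmoothEmbedding (𝓡 d) 𝓘(ℝ, Entries n) ∞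
      fun q : U2 n ⧸ Sp n => entries (quotSquare n q)) (q : U2 n ⧸ Sp n) :
    ∃ V : Set (U2 n ⧸ Sp n), IsOpen V ∧ q ∈ V ∧ ∃ s : U2 n ⧸ Sp n → U2 n,
      ContMDiffOn (𝓡 d) (𝓡 k) ∞ s V ∧ ∀ p ∈ V, (QuotientGroup.mk (s p) : U2 n ⧸ Sp n) = p := by
  obtain ⟨Q, rfl⟩ := QuotientGroup.mk_surjective q
  obtain ⟨r, V, hV, h1V, hr, hrV⟩ := exists_contDiffOn_section_squares n
  have ht : ContMDiff (𝓡 d) 𝓘(ℝ, CMat n) ∞ fun p : U2 n ⧸ Sp n => quotSquare n (Q⁻¹ • p) := by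
    simp_rw [quotSquare_smul]
    exact ((contDiff_const.mul contDiff_id).mul contDiff_const).contMDiff.comp
      (contMDiff_entries_comp_iff.1 hG.contMDiff)
  have hsec (p : U2 n ⧸ Sp n) (hp : quotSquare n (Q⁻¹ • p) ∈ V) :
      ∃ P : U2 n, (P : CMat n) = Q * r (quotSquare n (Q⁻¹ • p)) ∧
        (QuotientGroup.mk P : U2 n ⧸ Sp n) = p := by
    obtain ⟨hP, hPP⟩ := hrV _ hp (range_quotSquare.subset ⟨_, rfl⟩)
    have hmk : (QuotientGroup.mk (⟨_, hP⟩ : U2 n) : U2 n ⧸ Sp n) = Q⁻¹ • p :=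
      quotSquare_injective hPP
    refine ⟨Q * ⟨_, hP⟩, rfl, ?_⟩
    change Q • (QuotientGroup.mk (⟨_, hP⟩ : U2 n) : U2 n ⧸ Sp n) = p
    rw [hmk, smul_inv_smul]
  choose! s hs hmk using hsec
  have hVo := hV.preimage ht.continuous
  refine ⟨_, hVo, ?_, s, ?_, hmk⟩
  · change quotSquare n (QuotientGroup.mk (Q⁻¹ * Q)) ∈ V
    rwa [inv_mul_cancel, quotSquare_mk, Submonoid.coe_one, sAdj_one, mul_one]
  · refine contMDiffOn_of_isSmoothEmbedding_comp hU hVo (contMDiffOn_entries_comp_iff.2 ?_)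
    exact ((contDiffOn_const.mul hr).contMDiffOn.comp ht.contMDiffOn fun _ hp => hp).congr hs

end SmoothQuotient

section Diffeomorphisms

variable {n : ℕ}

/-- The bijection `[Q] ↦ Q Q^S`. -/
def quotEquiv (n : ℕ) : U2 n ⧸ Sp n ≃ squares n :=
  (Equiv.ofInjective _ quotSquare_injective).trans (Equiv.setCongr range_quotSquare)

theorem quotSquare_quotEquiv_symm (X : squares n) :
    quotSquare n ((quotEquiv n).symm X) = X :=
  congrArg Subtype.val ((quotEquiv n).apply_symm_apply X)

/-- The bijection which sends a Lagrangian subspace to its coordinate in the affine parametrization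
`lagrangianProj` of projections. -/
def lagrangianEquiv (n : ℕ) : LGr n ≃ squares n :=
  ((Equiv.ofInjective _ proj_injective).trans (Equiv.setCongr range_proj)).trans
    (Equiv.Set.image _ _ lagrangianProj_injective).symm

theorem lagrangianProj_lagrangianEquiv (W : LGr n) :
    lagrangianProj n (lagrangianEquiv n W) = proj W :=
  congrArg Subtype.val ((Equiv.Set.image _ _ lagrangianProj_injective).apply_symm_apply _)

theorem lagrangianEquiv_smul (A : U2 n) (W : LGr n) :
    (lagrangianEquiv n (A • W) : CMat n) = A * lagrangianEquiv n W * sAdj (A : CMat n) := by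
  have h (V : LGr n) := lagrangianProj_eq_proj_iff.1 (lagrangianProj_lagrangianEquiv V)
  exact conjAct_injective ((h (A • W)).trans (conjAct_eq_reflection_smul (h W) A).symm)

variable {d : ℕ} [ChartedSpace (EuclideanSpace ℝ (Fin d)) (U2 n ⧸ Sp n)]
  [ChartedSpace (EuclideanSpace ℝ (Fin d)) (squares n)]
  [ChartedSpace (EuclideanSpace ℝ (Fin d)) (LGr n)]

/-- `quotEquiv` as a diffeomorphism, if both sides are submanifolds of the space of matrices. -/
def quotDiffeomorph
    (hG : IsSmoothEmbedding (𝓡 d) 𝓘(ℝ, Entries n) ∞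
      fun q : U2 n ⧸ Sp n => entries (quotSquare n q))
    (hS : IsSmoothEmbedding (𝓡 d) 𝓘(ℝ, Entries n) ∞ fun X : squares n => entries (X : CMat n)) :
    (U2 n ⧸ Sp n) ≃ₘ^∞⟮𝓡 d, 𝓡 d⟯ squares n where
  toEquiv := quotEquiv n
  contMDiff_toFun := contMDiff_of_isSmoothEmbedding_comp hS hG.contMDiff
  contMDiff_invFun := contMDiff_of_isSmoothEmbedding_comp hG <|
    hS.contMDiff.congr fun X => congrArg entries (quotSquare_quotEquiv_symm X)

open scoped Matrix.Norms.L2Operator in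
/-- `lagrangianEquiv` as a diffeomorphism, if Lagrangian subspaces form a submanifold of the space
of projections and `squares n` is a submanifold of the space of matrices. -/
def lagrangianDiffeomorph
    (hL : IsSmoothEmbedding (𝓡 d) 𝓘(ℝ, HVec n →L[ℝ] HVec n) ∞
      (proj : LGr n → HVec n →L[ℝ] HVec n))
    (hS : IsSmoothEmbedding (𝓡 d) 𝓘(ℝ, Entries n) ∞ fun X : squares n => entries (X : CMat n)) :
    LGr n ≃ₘ^∞⟮𝓡 d, 𝓡 d⟯ squares n where
  toEquiv := lagrangianEquiv n
  contMDiff_toFun := by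
    obtain ⟨g, hg, hgi⟩ := exists_contDiff_leftInverse (E := CMat n)
      (E' := HVec n →L[ℝ] HVec n) (i := lagrangianProj n)
      lagrangianProj_injective
    refine contMDiff_of_isSmoothEmbedding_comp hS (contMDiff_entries_comp_iff.2 ?_)
    refine (hg.contMDiff.comp hL.contMDiff).congr fun W => ?_
    change (lagrangianEquiv n W : CMat n) = g (proj W)
    rw [← lagrangianProj_lagrangianEquiv, hgi]
  contMDiff_invFun := by
    refine contMDiff_of_isSmoothEmbedding_comp hL ?_
    refine ((contDiff_affineMap (lagrangianProj n)).contMDiff.comp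
      (contMDiff_entries_comp_iff.1 hS.contMDiff)).congr fun X => ?_
    change proj ((lagrangianEquiv n).symm X) = lagrangianProj n X
    rw [← lagrangianProj_lagrangianEquiv, Equiv.apply_symm_apply]

theorem quotEquiv_symm_lagrangianEquiv_smul (A : U2 n) (W : LGr n) :
    (quotEquiv n).symm (lagrangianEquiv n (A • W)) =
      A • (quotEquiv n).symm (lagrangianEquiv n W) := by
  refine quotSquare_injective ?_
  rw [quotSquare_smul, quotSquare_quotEquiv_symm, quotSquare_quotEquiv_symm, lagrangianEquiv_smul]

end Diffeomorphisms

end QLGr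

end

theorem mainTheorem9 (n : ℕ) (hn : 0 < n) :
    -- the three descriptions of the set of matrices
    QLGr.squares n = (QLGr.U2 n : Set (QLGr.CMat n)) ∩ (QLGr.Y2 n : Set (QLGr.CMat n)) ∧
    (QLGr.U2 n : Set (QLGr.CMat n)) ∩ (QLGr.Y2 n : Set (QLGr.CMat n)) =
      {X : QLGr.CMat n | X ∈ QLGr.U2 n ∧ X = QLGr.sAdj X} ∧
    -- the standard smooth structures exist on `U(2n)`, `LGr`, `U(2n)/Sp(n)` and `{Q Q^S}`
    ∃ (k d : ℕ)
      (_ : ChartedSpace (EuclideanSpace ℝ (Fin k)) (QLGr.U2 n))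
      (_ : ChartedSpace (EuclideanSpace ℝ (Fin d)) (QLGr.LGr n))
      (_ : ChartedSpace (EuclideanSpace ℝ (Fin d)) (QLGr.U2 n ⧸ QLGr.Sp n))
      (_ : ChartedSpace (EuclideanSpace ℝ (Fin d)) (QLGr.squares n)),
      IsManifold (𝓡 k) ∞ (QLGr.U2 n) ∧
      IsManifold (𝓡 d) ∞ (QLGr.LGr n) ∧
      IsManifold (𝓡 d) ∞ (QLGr.U2 n ⧸ QLGr.Sp n) ∧
      IsManifold (𝓡 d) ∞ (QLGr.squares n) ∧
      -- `U(2n)` and `{Q Q^S}` are embedded submanifolds of the space of complex matrices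
      IsSmoothEmbedding (𝓡 k) 𝓘(ℝ, QLGr.Entries n) ∞ (fun Q : QLGr.U2 n => QLGr.entries (Q : QLGr.CMat n)) ∧
      IsSmoothEmbedding (𝓡 d) 𝓘(ℝ, QLGr.Entries n) ∞
        (fun X : QLGr.squares n => QLGr.entries (X : QLGr.CMat n)) ∧
      -- `LGr` is an embedded submanifold of the Grassmannian, viewed as orthogonal projections
      IsSmoothEmbedding (𝓡 d) 𝓘(ℝ, QLGr.HVec n →L[ℝ] QLGr.HVec n) ∞
        (QLGr.proj : QLGr.LGr n → QLGr.HVec n →L[ℝ] QLGr.HVec n) ∧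
      -- `U(2n)/Sp(n)` carries the smooth structure of a homogeneous space
      QLGr.IsSmoothQuotient (k := k) (d := d) (QLGr.Sp n) ∧
      -- the two `U(2n)`-equivariant diffeomorphisms
      (∃ Φ : QLGr.LGr n ≃ₘ^∞⟮𝓡 d, 𝓡 d⟯ (QLGr.U2 n ⧸ QLGr.Sp n),
        ∀ (A : QLGr.U2 n) (W : QLGr.LGr n), Φ (A • W) = A • Φ W) ∧
      (∃ Ψ : (QLGr.U2 n ⧸ QLGr.Sp n) ≃ₘ^∞⟮𝓡 d, 𝓡 d⟯ QLGr.squares n,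
        ∀ (A : QLGr.U2 n) (q : QLGr.U2 n ⧸ QLGr.Sp n),
          ((Ψ (A • q) : QLGr.squares n) : QLGr.CMat n) =
            (A : QLGr.CMat n) * (Ψ q : QLGr.CMat n) * QLGr.sAdj (A : QLGr.CMat n)) := by
  obtain ⟨csU, mU, hU⟩ := QLGr.isSliced_unitaryGroup.exists_chartedSpace_entries
    (f := ((↑) : QLGr.U2 n → QLGr.CMat n)) .subtypeVal Subtype.range_coe
  obtain ⟨csS, mS, hS⟩ := QLGr.isSliced_squares.exists_chartedSpace_entries
    (f := ((↑) : QLGr.squares n → QLGr.CMat n)) .subtypeVal Subtype.range_coe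
  obtain ⟨csG, mG, hG⟩ := QLGr.isSliced_squares.exists_chartedSpace_entries
    (QLGr.isEmbedding_quotSquare (n := n)) QLGr.range_quotSquare
  obtain ⟨csL, mL, hL⟩ := QLGr.exists_chartedSpace_LGr n
  let Ψ := QLGr.quotDiffeomorph hG hS
  exact ⟨QLGr.squares_eq, rfl, _, _, csU, csL, csG, csS, mU, mL, mG, mS, hU, hS, hL,
    ⟨QLGr.contMDiff_mk hU hG, QLGr.exists_contMDiffOn_section hU hG⟩,
    ⟨(QLGr.lagrangianDiffeomorph hL hS).trans Ψ.symm, QLGr.quotEquiv_symm_lagrangianEquiv_smul⟩,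
    ⟨Ψ, QLGr.quotSquare_smul⟩⟩
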